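/- **Setting.** Fix a subjective Markov decision process (SMDP): nonempty finite sets $\mathbb S$ of states and $\mathbb X$ of actions; a correspondence $\Gamma$ assigning to each $s\in\mathbb S$ a nonempty set $\Gamma(s)\subseteq\mathbb X$ of feasible actions, with graph $G=\{(s,x):x\in\Gamma(s)\}$; an initial distribution $q_0\in\Delta(\mathbb S)$; a true transition function $Q:G\to\Delta(\mathbb S)$; a payoff $\pi:G\times\mathbb S\to\mathbb R$; and a family $Q_\theta:G\to\Delta(\mathbb S)$, $\theta\in\Theta$, where $\Theta\neq\emptyset$ is a subset of a Euclidean space. The discount factor is $\delta\in[0,1)$. The SMDP is *regular* if $\Theta$ is compact, $\theta\mapsto Q_\theta(s'\mid s,x)$ is continuous for all $s',s,x$, and there is a dense $\hat\Theta\subseteq\Theta$ such that for $\theta\in\hat\Theta$: $Q_\theta(s'\mid s,x)>0$ whenever $Q(s'\mid s,x)>0$. A *strategy* $\sigma$ assigns to each state $s$ a distribution $\sigma(\cdot\mid s)$ on $\Gamma(s)$; $\Sigma$ is the set of strategies. For a belief $\mu\in\Delta(\Theta)$ put $\bar Q_\mu=\int Q_\theta\,\mu(d\theta)$, and let $B(s,x,s',\mu)$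 be the posterior $A\mapsto\int_A Q_\theta(s'\mid s,x)\mu(d\theta)/\bar Q_\mu(s'\mid s,x)$ (arbitrary when the denominator is $0$). *Berk-Nash equilibrium.* $(\sigma,m)\in\Sigma\times\Delta(G)$ is a Berk-Nash equilibrium if there is $\mu\in\Delta(\Theta)$ such that: (a) $\sigma$ is optimal in the MDP with transition function $\bar Q_\mu$, i.e. $\sigma(\cdot\mid s)$ is supported on $\arg\max_{x\in\Gamma(s)}\sum_{s'}\{\pi(s,x,s')+\delta V(s')\}\bar Q_\mu(s'\mid s,x)$ for each $s$, where $V$ is the solution of the Bellman equation whose right-hand side is this maximum; (b) $\mu$ gives probability one to the set of minimizers over $\theta\in\Theta$ of $K_Q(m,\theta)=\sum_{(s,x)\in G}m(s,x)\sum_{s'}Q(s'\mid s,x)\ln\frac{Q(s'\mid s,x)}{Q_\theta(s'\mid s,x)}\in[0,\infty]$; (c) $m(s',x')=\sum_{(s,x)\in G}\sigma(x'\mid s')Q(s'\mid s,x)\,m(s,x)$ for all $(s',x')\in G$. *Learning.* A policy function $f:\Delta(\Theta)\to\Sigma$ is *optimal* if for all $\mu,s$, $f(\cdot\mid s,\mu)$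 is supported on $\arg\max_{x\in\Gamma(s)}\sum_{s'}\{\pi(s,x,s')+\delta W(s',B(s,x,s',\mu))\}\bar Q_\mu(s'\mid s,x)$, where $W:\mathbb S\times\Delta(\Theta)\to\mathbb R$ is the bounded solution of the Bellman equation whose right-hand side is this maximum. A prior $\mu_0$ and $f$ induce a law $\mathbf P^f$ on histories $h=(s_0,x_0,s_1,x_1,\dots)\in G^{\infty}$: $s_0\sim q_0$, $x_t\sim f(\cdot\mid s_t,\mu_t)$, $s_{t+1}\sim Q(\cdot\mid s_t,x_t)$, $\mu_{t+1}=B(s_t,x_t,s_{t+1},\mu_t)$. Let $\sigma_t(h)=f(\cdot\mid\cdot,\mu_t(h))$ and let $m_t(h)\in\Delta(G)$ be the empirical frequency of the outcomes $(s_\tau,x_\tau)$, $\tau\le t$. The pair $(\sigma,m)$ is *stable* if there is a set $\mathcal H$ of histories with $\mathbf P^f(\mathcal H)>0$ such that $\sigma_t(h)\to\sigma$ and $m_t(h)\to m$ for all $h\in\mathcal H$. It is *stable with exhaustive learning* if, in addition, for each $h\in\mathcal H$ some subsequence of $(\mu_t(h))_t$ converges weakly to a belief $\mu^*$ such that $\mu^*=B(s,x,s',\mu^*)$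 for all $(s,x)\in G$ and all $s'$ with $\bar Q_{\mu^*}(s'\mid s,x)>0$. **Theorem.** For every SMDP as above there exists $\bar\delta\in[0,1]$ (not depending on $\delta$, $\mu_0$, $f$, $\sigma$, $m$) such that, if the SMDP is regular, $\mu_0\in\Delta(\Theta)$ is a prior with full support, and $f$ is an optimal policy function for the discount factor $\delta$: (i) for all $\delta\in[0,1)$ with $\delta\le\bar\delta$, if $(\sigma,m)$ is stable, then $(\sigma,m)$ is a Berk-Nash equilibrium of the SMDP; (ii) for all $\delta\in[0,1)$ with $\delta>\bar\delta$, if $(\sigma,m)$ is stable with exhaustive learning, then $(\sigma,m)$ is a Berk-Nash equilibrium of the SMDP. -/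

import Mathlib

open Filter Topology MeasureTheory ProbabilityTheory

noncomputable section

/-- The graph `{(s, x) : x ∈ Γ s}` of a constraint correspondence: the feasible outcomes. -/
def Gr {S X : Type*} (Γ : S → Finset X) : Type _ := {p : S × X // p.2 ∈ Γ p.1}

namespace Gr

variable {S X : Type*} {Γ : S → Finset X}

/-- The state of an outcome. -/
def state (z : Gr Γ) : S := z.1.1

/-- The action of an outcome. -/
def action (z : Gr Γ) : X := z.1.2

open Classical in
instance [Fintype S] [Fintype X] : Fintype (Gr Γ) :=
  inferInstanceAs (Fintype {p : S × X // p.2 ∈ Γ p.1})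

instance : MeasurableSpace (Gr Γ) := ⊤

instance : DiscreteMeasurableSpace (Gr Γ) := ⟨fun _ => trivial⟩

/-- For a function `u` on outcomes, `IsArgmax u z` says that the action of `z` maximizes
`x ↦ u (s, x)` over `x ∈ Γ s`, where `s` is the state of `z`. -/
def IsArgmax (u : Gr Γ → ℝ) (z : Gr Γ) : Prop :=
  ∀ z' : Gr Γ, z'.state = z.state → u z' ≤ u z

/-- `IsMaxAt u s v` says that `v = max_{x ∈ Γ s} u (s, x)` (the maximum being attained). -/
def IsMaxAt (u : Gr Γ → ℝ) (s : S) (v : ℝ) : Prop :=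
  IsGreatest {r : ℝ | ∃ z : Gr Γ, z.state = s ∧ u z = r} v

end Gr

/-- Strategies: maps from states to distributions over actions, supported on feasible actions.
The topology is that of pointwise convergence. -/
abbrev Strategy {S X : Type*} [Fintype X] (Γ : S → Finset X) : Type _ :=
  {σ : S → X → ℝ // ∀ s, σ s ∈ stdSimplex ℝ X ∧ ∀ x, x ∉ Γ s → σ s x = 0}

/-- Distributions over outcomes, with the topology of pointwise convergence. -/
abbrev OutcomeDist {S X : Type*} [Fintype S] [Fintype X] (Γ : S → Finset X) : Type _ :=
  stdSimplex ℝ (Gr Γ)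

lemma sum_weights {S X : Type*} [Fintype S] [Fintype X] {Γ : S → Finset X}
    (p : stdSimplex ℝ S) (g : Strategy Γ) :
    ∑ z : Gr Γ, p.1 z.state * g.1 z.state z.action = 1 := by
  classical
  have h1 : ∑ z : Gr Γ, p.1 z.state * g.1 z.state z.action
      = ∑ a ∈ (Finset.univ : Finset (S × X)).filter (fun a => a.2 ∈ Γ a.1),
          p.1 a.1 * g.1 a.1 a.2 := by
    rw [Finset.sum_subtype (p := fun a : S × X => a.2 ∈ Γ a.1) (F := inferInstance)]
    · exact Finset.sum_congr rfl (fun _ _ => rfl)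
    · simp
  rw [h1, Finset.sum_filter_of_ne, Fintype.sum_prod_type]
  · simp_rw [← Finset.mul_sum, (g.2 _).1.2, mul_one, p.2.2]
  · intro a _ ha
    by_contra hn
    exact ha (by rw [(g.2 a.1).2 _ hn, mul_zero])

/-- The law of an outcome `(s, x)` when `s` is drawn from `p` and then `x` from `g (· ∣ s)`. -/
def outcomeLaw {S X : Type*} [Fintype S] [Fintype X] {Γ : S → Finset X}
    (p : stdSimplex ℝ S) (g : Strategy Γ) : Measure (Gr Γ) :=
  ∑ z : Gr Γ, ENNReal.ofReal (p.1 z.state * g.1 z.state z.action) • Measure.dirac z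

instance {S X : Type*} [Fintype S] [Fintype X] {Γ : S → Finset X}
    (p : stdSimplex ℝ S) (g : Strategy Γ) : IsProbabilityMeasure (outcomeLaw p g) := by
  refine ⟨?_⟩
  simp only [outcomeLaw, Measure.coe_finsetSum, Finset.sum_apply, Measure.smul_apply,
    measure_univ, smul_eq_mul, mul_one]
  rw [← ENNReal.ofReal_sum_of_nonneg, sum_weights, ENNReal.ofReal_one]
  exact fun z _ => mul_nonneg (p.2.1 _) ((g.2 _).1.1 _)

/-- A Markov decision process with finitely many states and actions. The discount factor `δ` is
not a field: it is an explicit argument of the notions that depend on it, so that it can vary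
while everything else is fixed. -/
structure MDP (S X : Type*) [Fintype S] [Fintype X] where
  /-- the constraint correspondence -/
  Γ : S → Finset X
  Γ_nonempty : ∀ s, (Γ s).Nonempty
  /-- the distribution of the initial state -/
  q₀ : stdSimplex ℝ S
  /-- the true transition probability function, `(Q (s, x)).1 s' = Q(s' ∣ s, x)` -/
  Q : Gr Γ → stdSimplex ℝ S
  /-- the per-period payoff -/
  payoff : Gr Γ → S → ℝ

/-- A subjective Markov decision process: a Markov decision process together with a nonempty
family of transition probability functions indexed by a set `Θ` of parameters. -/
structure SMDP (S X : Type*) [Fintype S] [Fintype X] {d : ℕ}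
    (Θ : Set (EuclideanSpace ℝ (Fin d))) extends MDP S X where
  Θ_nonempty : Θ.Nonempty
  /-- the subjective models, `(model θ (s, x)).1 s' = Q_θ(s' ∣ s, x)` -/
  model : Θ → Gr Γ → stdSimplex ℝ S

namespace MDP

variable {S X : Type*} [Fintype S] [Fintype X] (D : MDP S X)

/-- `∫ {π(s, x, s') + δ V(s')} q(ds' ∣ s, x)` for the outcome `z = (s, x)`. -/
def actionValue (δ : ℝ) (q : Gr D.Γ → S → ℝ) (V : S → ℝ) (z : Gr D.Γ) : ℝ :=
  ∑ s', (D.payoff z s' + δ * V s') * q z s'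

/-- `V` solves the Bellman equation of the MDP with transition probability function `q`. -/
def IsValue (δ : ℝ) (q : Gr D.Γ → S → ℝ) (V : S → ℝ) : Prop :=
  ∀ s, Gr.IsMaxAt (D.actionValue δ q V) s (V s)

/-- `σ` is an optimal strategy for the MDP with transition probability function `q`. (For
`δ ∈ [0,1)` the Bellman equation has exactly one solution.) -/
def IsOptimal (δ : ℝ) (q : Gr D.Γ → S → ℝ) (σ : Strategy D.Γ) : Prop :=
  ∃ V : S → ℝ, D.IsValue δ q V ∧
    ∀ z : Gr D.Γ, 0 < σ.1 z.state z.action → Gr.IsArgmax (D.actionValue δ q V) z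

/-- The transition kernel `M_{σ,Q}(z' ∣ z) = σ(x' ∣ s') Q(s' ∣ s, x)` on outcomes,
`z = (s, x)`, `z' = (s', x')`, for the true transition probability function. -/
def transition (σ : Strategy D.Γ) (z z' : Gr D.Γ) : ℝ :=
  σ.1 z'.state z'.action * (D.Q z).1 z'.state

/-- `m` is a stationary distribution given `(σ, Q)`. -/
def IsStationary (σ : Strategy D.Γ) (m : OutcomeDist D.Γ) : Prop :=
  ∀ z', m.1 z' = ∑ z, D.transition σ z z' * m.1 z

end MDP

/-- The summand `p log (p / q)` of the Kullback-Leibler divergence, with the usual conventions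
`0 log (0 / q) = 0` and `p log (p / 0) = ∞` for `p > 0`. -/
def klTerm (p q : ℝ) : EReal :=
  open Classical in
  if p = 0 then 0 else if q = 0 then ⊤ else ((p * Real.log (p / q) : ℝ) : EReal)

namespace SMDP

variable {S X : Type*} [Fintype S] [Fintype X] {d : ℕ} {Θ : Set (EuclideanSpace ℝ (Fin d))}
  (D : SMDP S X Θ)

/-- Regularity: compact parameter set, continuity of the models in the parameter, and a dense set
of models that give positive probability to all feasible transitions. -/
structure Regular : Prop where
  compact : IsCompact Θ
  continuous : ∀ (z : Gr D.Γ) (s' : S), Continuous fun θ : Θ => (D.model θ z).1 s'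
  dense : ∃ A : Set Θ, Dense A ∧
    ∀ θ ∈ A, ∀ (z : Gr D.Γ) (s' : S), 0 < (D.Q z).1 s' → 0 < (D.model θ z).1 s'

/-- The weighted Kullback-Leibler divergence `K_Q(m, θ)`, an extended real number
(in `EReal` one has `0 * ⊤ = 0`). -/
def wKLD (m : OutcomeDist D.Γ) (θ : Θ) : EReal :=
  ∑ z : Gr D.Γ, (m.1 z : EReal) * ∑ s', klTerm ((D.Q z).1 s') ((D.model θ z).1 s')

/-- The set `Θ_Q(m)` of closest parameter values given `m`. -/
def closest (m : OutcomeDist D.Γ) : Set Θ :=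
  {θ | ∀ θ', D.wKLD m θ ≤ D.wKLD m θ'}

/-- The subjective transition probability `Q̄_μ(s' ∣ s, x) = ∫ Q_θ(s' ∣ s, x) μ(dθ)`. -/
def Qbar (μ : ProbabilityMeasure Θ) (z : Gr D.Γ) (s' : S) : ℝ :=
  ∫ θ, (D.model θ z).1 s' ∂(μ : Measure Θ)

/-- `(σ, m)` is a Berk-Nash equilibrium (for the discount factor `δ`). -/
def IsBerkNash (δ : ℝ) (σ : Strategy D.Γ) (m : OutcomeDist D.Γ) : Prop :=
  ∃ μ : ProbabilityMeasure Θ,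
    D.IsOptimal δ (D.Qbar μ) σ ∧
    (∀ᵐ θ ∂(μ : Measure Θ), θ ∈ D.closest m) ∧
    D.IsStationary σ m

lemma isProbabilityMeasure_posterior (z : Gr D.Γ) (s' : S) (μ : ProbabilityMeasure Θ)
    (h : 0 < D.Qbar μ z s') :
    IsProbabilityMeasure ((ENNReal.ofReal (D.Qbar μ z s'))⁻¹ •
      (μ : Measure Θ).withDensity fun θ => ENNReal.ofReal ((D.model θ z).1 s')) := by
  have hi : Integrable (fun θ => (D.model θ z).1 s') (μ : Measure Θ) := by
    by_contra hn
    exact h.ne' (integral_undef hn)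
  refine ⟨?_⟩
  rw [Measure.smul_apply, withDensity_apply _ MeasurableSet.univ, Measure.restrict_univ,
    ← ofReal_integral_eq_lintegral_ofReal hi (ae_of_all _ fun θ => (D.model θ z).2.1 s'),
    smul_eq_mul]
  exact ENNReal.inv_mul_cancel (by simpa using h) ENNReal.ofReal_ne_top

open Classical in
/-- The Bayesian operator `B(s, x, s', μ)`, with `z = (s, x)`: the posterior
`A ↦ ∫_A Q_θ(s' ∣ s, x) μ(dθ) / ∫_Θ Q_θ(s' ∣ s, x) μ(dθ)` where the denominator is positive
(and `μ` itself otherwise, an arbitrary choice). -/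
def bayes (z : Gr D.Γ) (s' : S) (μ : ProbabilityMeasure Θ) : ProbabilityMeasure Θ :=
  if h : 0 < D.Qbar μ z s' then
    ⟨(ENNReal.ofReal (D.Qbar μ z s'))⁻¹ •
      (μ : Measure Θ).withDensity fun θ => ENNReal.ofReal ((D.model θ z).1 s'),
      D.isProbabilityMeasure_posterior z s' μ h⟩
  else μ

/-- `∫ {π(s, x, s') + δ W(s', B(s, x, s', μ))} Q̄_μ(ds' ∣ s, x)` for the outcome `z = (s, x)`. -/
def bayesActionValue (δ : ℝ) (W : S → ProbabilityMeasure Θ → ℝ) (μ : ProbabilityMeasure Θ)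
    (z : Gr D.Γ) : ℝ :=
  ∑ s', (D.payoff z s' + δ * W s' (D.bayes z s' μ)) * D.Qbar μ z s'

/-- `W` is the value function of the Bayesian problem: the bounded solution of the Bellman equation
in which the belief is part of the state. -/
def IsBayesValue (δ : ℝ) (W : S → ProbabilityMeasure Θ → ℝ) : Prop :=
  (∃ C, ∀ s μ, |W s μ| ≤ C) ∧
    ∀ s μ, Gr.IsMaxAt (D.bayesActionValue δ W μ) s (W s μ)

/-- A policy function `f`, mapping beliefs to strategies, is optimal for the Bayesian problem.
(For `δ ∈ [0,1)` the Bellman equation has exactly one bounded solution.) -/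
def IsOptimalPolicy (δ : ℝ) (f : ProbabilityMeasure Θ → Strategy D.Γ) : Prop :=
  ∃ W : S → ProbabilityMeasure Θ → ℝ, D.IsBayesValue δ W ∧
    ∀ (μ : ProbabilityMeasure Θ) (z : Gr D.Γ), 0 < (f μ).1 z.state z.action →
      Gr.IsArgmax (D.bayesActionValue δ W μ) z

/-- The belief `μ_t` after the infinite history `h = (s₀, x₀, s₁, x₁, …)`. -/
def belief (μ₀ : ProbabilityMeasure Θ) (h : ℕ → Gr D.Γ) : ℕ → ProbabilityMeasure Θ
  | 0 => μ₀
  | t + 1 => D.bayes (h t) (h (t + 1)).state (belief μ₀ h t)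

/-- Given the current outcome `z` and belief `μ`, the behavior next period: in state `s'` the agent
first updates to `B(z, s', μ)` and then follows the policy function. -/
def nextStrategy (f : ProbabilityMeasure Θ → Strategy D.Γ) (μ : ProbabilityMeasure Θ)
    (z : Gr D.Γ) : Strategy D.Γ :=
  ⟨fun s' => (f (D.bayes z s' μ)).1 s', fun s' => (f (D.bayes z s' μ)).2 s'⟩

/-- A finite history `(z₀, …, z_t)`, continued in an arbitrary way to an infinite one (beliefs up to
time `t` depend on `z₀, …, z_t` only). -/
def extend {t : ℕ} (h : Π _ : Finset.Iic t, Gr D.Γ) : ℕ → Gr D.Γ :=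
  fun i => h ⟨min i t, Finset.mem_Iic.2 (min_le_right i t)⟩

/-- The law of the outcome of period `t + 1` given the outcomes of periods `0, …, t`: the new state
is drawn from the true transition probability, and the action from the policy function at the
updated belief. -/
def stepKernel (μ₀ : ProbabilityMeasure Θ) (f : ProbabilityMeasure Θ → Strategy D.Γ) (t : ℕ) :
    Kernel (Π _ : Finset.Iic t, Gr D.Γ) (Gr D.Γ) :=
  Kernel.ofFunOfCountable fun h =>
    outcomeLaw (D.Q (D.extend h t))
      (D.nextStrategy f (D.belief μ₀ (D.extend h) t) (D.extend h t))

instance (μ₀ : ProbabilityMeasure Θ) (f : ProbabilityMeasure Θ → Strategy D.Γ) (t : ℕ) :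
    IsMarkovKernel (D.stepKernel μ₀ f t) :=
  ⟨fun h => inferInstanceAs (IsProbabilityMeasure (outcomeLaw (D.Q (D.extend h t))
      (D.nextStrategy f (D.belief μ₀ (D.extend h) t) (D.extend h t))))⟩

/-- The probability distribution `P^f` over infinite histories induced by the primitives, the prior
and the policy function (Ionescu-Tulcea). -/
def historyLaw (μ₀ : ProbabilityMeasure Θ) (f : ProbabilityMeasure Θ → Strategy D.Γ) :
    Measure (ℕ → Gr D.Γ) :=
  Kernel.trajMeasure (X := fun _ => Gr D.Γ) (outcomeLaw D.q₀ (f μ₀)) (D.stepKernel μ₀ f)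

open Classical in
/-- The empirical frequency `m_t` of the outcomes of periods `0, …, t`. -/
def freq (h : ℕ → Gr D.Γ) (t : ℕ) (z : Gr D.Γ) : ℝ :=
  (1 / ((t : ℝ) + 1)) * ∑ τ ∈ Finset.range (t + 1), if h τ = z then 1 else 0

/-- Along the history `h`, strategies converge to `σ` and empirical frequencies to `m`. -/
def Converges (μ₀ : ProbabilityMeasure Θ) (f : ProbabilityMeasure Θ → Strategy D.Γ)
    (σ : Strategy D.Γ) (m : OutcomeDist D.Γ) (h : ℕ → Gr D.Γ) : Prop :=
  Tendsto (fun t => f (D.belief μ₀ h t)) atTop (𝓝 σ) ∧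
    ∀ z, Tendsto (fun t => D.freq h t z) atTop (𝓝 (m.1 z))

/-- `(σ, m)` is stable for the prior `μ₀` and the policy function `f`. -/
def IsStable (μ₀ : ProbabilityMeasure Θ) (f : ProbabilityMeasure Θ → Strategy D.Γ)
    (σ : Strategy D.Γ) (m : OutcomeDist D.Γ) : Prop :=
  ∃ H : Set (ℕ → Gr D.Γ), MeasurableSet H ∧ 0 < D.historyLaw μ₀ f H ∧
    ∀ h ∈ H, D.Converges μ₀ f σ m h

/-- Under the belief `μ` all learning possibilities are exhausted: `μ` is a fixed point of the
Bayesian operator at every transition that has positive probability under `Q̄_μ`. -/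
def Exhausted (μ : ProbabilityMeasure Θ) : Prop :=
  ∀ (z : Gr D.Γ) (s' : S), 0 < D.Qbar μ z s' → μ = D.bayes z s' μ

/-- `(σ, m)` is stable with exhaustive learning: it is stable, and along each history in question
some subsequence of beliefs converges weakly to a belief under which learning is exhausted. -/
def IsStableExhaustive (μ₀ : ProbabilityMeasure Θ) (f : ProbabilityMeasure Θ → Strategy D.Γ)
    (σ : Strategy D.Γ) (m : OutcomeDist D.Γ) : Prop :=
  ∃ H : Set (ℕ → Gr D.Γ), MeasurableSet H ∧ 0 < D.historyLaw μ₀ f H ∧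
    ∀ h ∈ H, D.Converges μ₀ f σ m h ∧
      ∃ (μ : ProbabilityMeasure Θ) (φ : ℕ → ℕ), StrictMono φ ∧
        Tendsto (fun j => D.belief μ₀ h (φ j)) atTop (𝓝 μ) ∧ D.Exhausted μ

end SMDP

/-- A belief has full support if it charges every nonempty (relatively) open set of parameters. -/
def FullSupport {d : ℕ} {Θ : Set (EuclideanSpace ℝ (Fin d))} (μ : ProbabilityMeasure Θ) : Prop :=
  ∀ U : Set Θ, IsOpen U → U.Nonempty → 0 < (μ : Measure Θ) U

end

noncomputable section

/-! The threshold is taken to be `0`. Then (i) concerns only the myopic agent, whose continuation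
value is multiplied by zero, and (ii) concerns agents whose limit belief is a fixed point of
Bayesian updating. In both cases the Bayesian decision problem at the limit belief coincides with
the Markov decision problem for `Qbar μ`.

One typical history suffices. Almost surely only transitions of positive true probability occur, and
two averages of bounded martingale differences vanish: realized state minus `Q`, and realized action
minus the policy (`ae_tendsto_average`). An event of positive probability contains a history with
all these properties (`exists_typical_history`). Along it, transition frequencies converge to `m *
Q`, and convergence of strategies makes `m` stationary.

Let `μ` be a limit of beliefs along this history: a cluster point by compactness in the myopic case,
the given subsequential limit otherwise. Two facts remain.

Concentration: the posterior is the prior reweighted by the likelihood. If `θ₀` does not minimize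
the divergence, likelihoods near `θ₀` are at most `exp (t * r₀)` and near some other `θ₁` at least
`exp (t * r₁)` with `r₀ < r₁`. Full support makes the posterior of a neighborhood of `θ₀` vanish
exponentially (`exists_isOpen_belief_tendsto_zero`), so `μ` does not charge it.

Optimality: each action value of the Bayesian problem is continuous in the belief
(`IsBayesValue.continuous_bayesActionValue`). Actions played with positive probability under the
limit strategy are eventually played along the limit, hence remain optimal at `μ`
(`isOptimal_of_tendsto`). -/

lemma Gr.IsMaxAt.abs_sub_le {S X : Type*} {Γ : S → Finset X} {u u' : Gr Γ → ℝ} {s : S} {v v' c : ℝ}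
    (h : Gr.IsMaxAt u s v) (h' : Gr.IsMaxAt u' s v') (hc : ∀ z, |u z - u' z| ≤ c) :
    |v - v'| ≤ c := by
  obtain ⟨⟨z, hz, rfl⟩, hu⟩ := h
  obtain ⟨⟨z', hz', rfl⟩, hu'⟩ := h'
  have h1 := hu' ⟨z, hz, rfl⟩
  have h2 := hu ⟨z', hz', rfl⟩
  have h3 := abs_le.1 (hc z)
  have h4 := abs_le.1 (hc z')
  exact abs_le.2 ⟨by linarith, by linarith⟩

/-! ### Continuity of Bayesian action values and optimality in the limit -/

namespace SMDP

variable {S X : Type*} [Fintype S] [Fintype X] {d : ℕ} {Θ : Set (EuclideanSpace ℝ (Fin d))}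
  {D : SMDP S X Θ}

lemma model_nonneg (θ : Θ) (z : Gr D.Γ) (s' : S) : 0 ≤ (D.model θ z).1 s' :=
  (D.model θ z).2.1 s'

lemma model_le_one (θ : Θ) (z : Gr D.Γ) (s' : S) : (D.model θ z).1 s' ≤ 1 :=
  (mem_Icc_of_mem_stdSimplex (D.model θ z).2 s').2

lemma integrable_model (hR : D.Regular) (μ : ProbabilityMeasure Θ) (z : Gr D.Γ) (s' : S) :
    Integrable (fun θ => (D.model θ z).1 s') (μ : Measure Θ) :=
  Integrable.of_bound (hR.continuous z s').measurable.aestronglyMeasurable 1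
    (ae_of_all _ fun θ => by
      rw [Real.norm_of_nonneg (model_nonneg θ z s')]; exact model_le_one θ z s')

lemma Qbar_nonneg (μ : ProbabilityMeasure Θ) (z : Gr D.Γ) (s' : S) : 0 ≤ D.Qbar μ z s' :=
  integral_nonneg fun θ => model_nonneg θ z s'

lemma sum_Qbar (hR : D.Regular) (μ : ProbabilityMeasure Θ) (z : Gr D.Γ) :
    ∑ s', D.Qbar μ z s' = 1 := by
  unfold Qbar
  rw [← integral_finsetSum _ fun s' _ => integrable_model hR μ z s']
  simp [(D.model _ z).2.2]

lemma Qbar_le_one (hR : D.Regular) (μ : ProbabilityMeasure Θ) (z : Gr D.Γ) (s' : S) :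
    D.Qbar μ z s' ≤ 1 := by
  rw [← sum_Qbar hR μ z]
  exact Finset.single_le_sum (fun s _ => Qbar_nonneg μ z s) (Finset.mem_univ s')

lemma continuous_integral_of_continuous (hR : D.Regular) {g : Θ → ℝ} (hg : Continuous g) :
    Continuous fun μ : ProbabilityMeasure Θ => ∫ θ, g θ ∂(μ : Measure Θ) := by
  have : CompactSpace Θ := isCompact_iff_compactSpace.1 hR.compact
  exact ProbabilityMeasure.continuous_integral_continuousMap (⟨g, hg⟩ : C(Θ, ℝ))

lemma continuous_Qbar (hR : D.Regular) (z : Gr D.Γ) (s' : S) :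
    Continuous fun μ => D.Qbar μ z s' :=
  continuous_integral_of_continuous hR (hR.continuous z s')

lemma toMeasure_bayes {μ : ProbabilityMeasure Θ} {z : Gr D.Γ} {s' : S} (h : 0 < D.Qbar μ z s') :
    (D.bayes z s' μ : Measure Θ) = (ENNReal.ofReal (D.Qbar μ z s'))⁻¹ •
      (μ : Measure Θ).withDensity fun θ => ENNReal.ofReal ((D.model θ z).1 s') := by
  have hb : D.bayes z s' μ = ⟨_, D.isProbabilityMeasure_posterior z s' μ h⟩ := dif_pos h
  rw [hb]
  rfl

lemma integral_bayes (hR : D.Regular) {μ : ProbabilityMeasure Θ} {z : Gr D.Γ} {s' : S}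
    (h : 0 < D.Qbar μ z s') (g : Θ → ℝ) :
    ∫ θ, g θ ∂(D.bayes z s' μ : Measure Θ)
      = (D.Qbar μ z s')⁻¹ * ∫ θ, g θ * (D.model θ z).1 s' ∂(μ : Measure Θ) := by
  rw [toMeasure_bayes h, integral_smul_measure,
    integral_withDensity_eq_integral_toReal_smul
      (hR.continuous z s').measurable.ennreal_ofReal (ae_of_all _ fun _ => ENNReal.ofReal_lt_top),
    ENNReal.toReal_inv, ENNReal.toReal_ofReal h.le, smul_eq_mul]
  congr 1
  refine integral_congr_ae (ae_of_all _ fun θ => ?_)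
  simp only [smul_eq_mul, ENNReal.toReal_ofReal (model_nonneg θ z s')]
  exact mul_comm _ _

lemma continuousAt_bayes (hR : D.Regular) {μ : ProbabilityMeasure Θ} {z : Gr D.Γ} {s' : S}
    (h : 0 < D.Qbar μ z s') : ContinuousAt (D.bayes z s') μ := by
  refine ProbabilityMeasure.tendsto_iff_forall_integral_tendsto.2 fun g => ?_
  have hQ := (continuous_Qbar hR z s').tendsto μ
  have hg := (continuous_integral_of_continuous hR
    (g.continuous.mul (hR.continuous z s'))).tendsto μ
  rw [integral_bayes hR h]
  refine ((hQ.inv₀ h.ne').mul hg).congr' ?_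
  filter_upwards [hQ.eventually (lt_mem_nhds h)] with ν hν
  rw [integral_bayes hR hν]; rfl

/-- Oscillation bound for one summand of `bayesActionValue`: an oscillation `c` of the continuation
value contributes at most `δ c Q̄_μ(s' ∣ s, x)`. -/
lemma eventually_abs_bayes_summand_sub_le (hR : D.Regular) {δ : ℝ} (hδ : 0 ≤ δ) (hδ1 : δ ≤ 1)
    {W : S → ProbabilityMeasure Θ → ℝ}
    {C : ℝ} (hC : ∀ s μ, |W s μ| ≤ C) {c : ℝ}
    (hc : ∀ s μ, ∀ ε > 0, ∀ᶠ ν in 𝓝 μ, |W s ν - W s μ| ≤ c + ε)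
    (μ : ProbabilityMeasure Θ) (z : Gr D.Γ) (s' : S) {ε : ℝ} (hε : 0 < ε) :
    ∀ᶠ ν in 𝓝 μ, |(D.payoff z s' + δ * W s' (D.bayes z s' ν)) * D.Qbar ν z s'
      - (D.payoff z s' + δ * W s' (D.bayes z s' μ)) * D.Qbar μ z s'|
      ≤ δ * c * D.Qbar μ z s' + ε := by
  have hC0 : 0 ≤ C := (abs_nonneg _).trans (hC s' μ)
  set A := |D.payoff z s'| + C with hA
  have hA0 : 0 ≤ A := by positivity
  have hQ := (continuous_Qbar hR z s').tendsto μ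
  have hsmall : ∀ᶠ ν in 𝓝 μ, A * |D.Qbar ν z s' - D.Qbar μ z s'| < ε / 2 := by
    have : Tendsto (fun ν => A * |D.Qbar ν z s' - D.Qbar μ z s'|) (𝓝 μ) (𝓝 0) := by
      simpa using ((hQ.sub_const (D.Qbar μ z s')).abs.const_mul A)
    exact this.eventually (gt_mem_nhds (by positivity))
  have hW : ∀ ν, |D.payoff z s' + δ * W s' ν| ≤ A := fun ν => by
    refine (abs_add_le _ _).trans (add_le_add le_rfl ?_)
    rw [abs_mul, abs_of_nonneg hδ]
    exact (mul_le_of_le_one_left (abs_nonneg _) hδ1).trans (hC s' ν)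
  have hdiff : ∀ᶠ ν in 𝓝 μ, |W s' (D.bayes z s' ν) - W s' (D.bayes z s' μ)| * D.Qbar μ z s'
      ≤ c * D.Qbar μ z s' + ε / 2 := by
    -- Updating may be discontinuous where the predicted probability is zero, but there the summand
    -- has weight zero.
    rcases (Qbar_nonneg μ z s').eq_or_lt with h0 | h0
    · simp only [← h0, mul_zero, zero_add]
      exact Eventually.of_forall fun _ => by positivity
    · filter_upwards [(continuousAt_bayes hR h0).eventually
        (hc s' (D.bayes z s' μ) (ε / 2) (by positivity))] with ν hν
      have := mul_le_mul_of_nonneg_right hν h0.le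
      nlinarith [Qbar_le_one hR μ z s']
  filter_upwards [hsmall, hdiff] with ν h1 h2
  -- The change splits into a change of weight, small by continuity of `Qbar`, and a change of
  -- continuation value, controlled by `c`.
  have hid : (D.payoff z s' + δ * W s' (D.bayes z s' ν)) * D.Qbar ν z s'
      - (D.payoff z s' + δ * W s' (D.bayes z s' μ)) * D.Qbar μ z s'
      = (D.payoff z s' + δ * W s' (D.bayes z s' ν)) * (D.Qbar ν z s' - D.Qbar μ z s')
        + δ * ((W s' (D.bayes z s' ν) - W s' (D.bayes z s' μ)) * D.Qbar μ z s') := by ring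
  rw [hid]
  refine (abs_add_le _ _).trans ?_
  rw [abs_mul, abs_mul δ, abs_mul, abs_of_nonneg hδ, abs_of_nonneg (Qbar_nonneg μ z s')]
  have h3 := mul_le_mul_of_nonneg_right (hW (D.bayes z s' ν))
    (abs_nonneg (D.Qbar ν z s' - D.Qbar μ z s'))
  have h4 := mul_le_mul_of_nonneg_left h2 hδ
  nlinarith

lemma eventually_abs_bayesActionValue_sub_le (hR : D.Regular) {δ : ℝ} (hδ : 0 ≤ δ) (hδ1 : δ ≤ 1)
    {W : S → ProbabilityMeasure Θ → ℝ} {C : ℝ} (hC : ∀ s μ, |W s μ| ≤ C) {c : ℝ}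
    (hc : ∀ s μ, ∀ ε > 0, ∀ᶠ ν in 𝓝 μ, |W s ν - W s μ| ≤ c + ε)
    (μ : ProbabilityMeasure Θ) {ε : ℝ} (hε : 0 < ε) :
    ∀ᶠ ν in 𝓝 μ, ∀ z,
      |D.bayesActionValue δ W ν z - D.bayesActionValue δ W μ z| ≤ δ * c + ε := by
  refine eventually_all.2 fun z => ?_
  have hcard : (0 : ℝ) < Fintype.card S + 1 := by positivity
  filter_upwards [eventually_all.2 fun s' => eventually_abs_bayes_summand_sub_le hR hδ hδ1 hC hc
    μ z s' (div_pos hε hcard)] with ν hν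
  rw [bayesActionValue, bayesActionValue, ← Finset.sum_sub_distrib]
  refine (Finset.abs_sum_le_sum_abs _ _).trans ((Finset.sum_le_sum fun s' _ => hν s').trans ?_)
  rw [Finset.sum_add_distrib, ← Finset.mul_sum, sum_Qbar hR, mul_one, Finset.sum_const,
    nsmul_eq_mul, Finset.card_univ]
  have : (Fintype.card S : ℝ) * (ε / (Fintype.card S + 1)) ≤ ε := by
    rw [mul_div_assoc', div_le_iff₀ hcard]; nlinarith
  linarith

/-- The Bellman equation turns a local oscillation bound `c`, valid at every belief, into `δ * c`.
Start from the trivial bound `2 * C` and iterate: the given bounded solution is thereby continuous,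
without appeal to uniqueness. -/
lemma IsBayesValue.eventually_abs_sub_le (hR : D.Regular) {δ : ℝ} (hδ : 0 ≤ δ) (hδ1 : δ ≤ 1)
    {W : S → ProbabilityMeasure Θ → ℝ} (hW : D.IsBayesValue δ W) {C : ℝ}
    (hC : ∀ s μ, |W s μ| ≤ C) (n : ℕ) (s : S) (μ : ProbabilityMeasure Θ) (ε : ℝ) (hε : 0 < ε) :
    ∀ᶠ ν in 𝓝 μ, |W s ν - W s μ| ≤ δ ^ n * (2 * C) + ε := by
  induction n generalizing s μ ε with
  | zero =>
    refine Eventually.of_forall fun ν => ?_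
    have := (abs_sub (W s ν) (W s μ)).trans (add_le_add (hC s ν) (hC s μ))
    rw [pow_zero]; linarith
  | succ n ih =>
    filter_upwards [eventually_abs_bayesActionValue_sub_le hR hδ hδ1 hC ih μ hε] with ν hν
    rw [pow_succ', mul_assoc]
    exact (hW.2 s ν).abs_sub_le (hW.2 s μ) hν

lemma IsBayesValue.eventually_abs_sub_le_zero (hR : D.Regular) {δ : ℝ} (hδ : 0 ≤ δ) (hδ1 : δ < 1)
    {W : S → ProbabilityMeasure Θ → ℝ} (hW : D.IsBayesValue δ W)
    (s : S) (μ : ProbabilityMeasure Θ) (ε : ℝ) (hε : 0 < ε) :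
    ∀ᶠ ν in 𝓝 μ, |W s ν - W s μ| ≤ 0 + ε := by
  obtain ⟨C, hC⟩ := hW.1
  have h0 : Tendsto (fun n : ℕ => δ ^ n * (2 * C)) atTop (𝓝 0) := by
    simpa using (tendsto_pow_atTop_nhds_zero_of_lt_one hδ hδ1).mul_const (2 * C)
  obtain ⟨n, hn⟩ := (h0.eventually (gt_mem_nhds (half_pos hε))).exists
  filter_upwards [hW.eventually_abs_sub_le hR hδ hδ1.le hC n s μ (ε / 2) (half_pos hε)] with ν hν
  linarith

/-- The value of each action in the Bayesian problem is continuous in the belief. -/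
lemma IsBayesValue.continuous_bayesActionValue (hR : D.Regular) {δ : ℝ} (hδ : 0 ≤ δ)
    (hδ1 : δ < 1) {W : S → ProbabilityMeasure Θ → ℝ} (hW : D.IsBayesValue δ W) (z : Gr D.Γ) :
    Continuous fun μ => D.bayesActionValue δ W μ z := by
  obtain ⟨C, hC⟩ := hW.1
  refine continuous_iff_continuousAt.2 fun μ => Metric.tendsto_nhds.2 fun ε hε => ?_
  filter_upwards [eventually_abs_bayesActionValue_sub_le hR hδ hδ1.le hC
    (hW.eventually_abs_sub_le_zero hR hδ hδ1) μ (half_pos hε)] with ν hν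
  rw [Real.dist_eq]
  have := hν z
  linarith

/-- The posterior drops out because it is discounted to nothing or because it equals the belief;
transitions of predicted probability zero carry no weight, so the arbitrary posterior there is
harmless. -/
lemma bayesActionValue_eq_actionValue {δ : ℝ} {W : S → ProbabilityMeasure Θ → ℝ}
    {μ : ProbabilityMeasure Θ} (h : δ = 0 ∨ D.Exhausted μ) (z : Gr D.Γ) :
    D.bayesActionValue δ W μ z = D.actionValue δ (D.Qbar μ) (fun s => W s μ) z := by
  refine Finset.sum_congr rfl fun s' _ => ?_
  rcases h with rfl | h
  · simp
  · rcases (Qbar_nonneg μ z s').eq_or_lt with h0 | h0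
    · simp [← h0]
    · rw [← h z s' h0]

/-- Limits of optimal behavior are optimal for the Markov decision process of the limit belief,
provided that the agent is myopic or has nothing to learn at this belief. -/
lemma isOptimal_of_tendsto (hR : D.Regular) {δ : ℝ} (hδ : 0 ≤ δ) (hδ1 : δ < 1)
    {f : ProbabilityMeasure Θ → Strategy D.Γ} (hf : D.IsOptimalPolicy δ f) {ι : Type*}
    {F : Filter ι} [F.NeBot] {β : ι → ProbabilityMeasure Θ} {μ : ProbabilityMeasure Θ}
    {σ : Strategy D.Γ} (hβ : Tendsto β F (𝓝 μ)) (hσ : Tendsto (fun i => f (β i)) F (𝓝 σ))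
    (hμ : δ = 0 ∨ D.Exhausted μ) : D.IsOptimal δ (D.Qbar μ) σ := by
  obtain ⟨W, hW, hopt⟩ := hf
  have hval : D.bayesActionValue δ W μ = D.actionValue δ (D.Qbar μ) (fun s => W s μ) :=
    funext fun z => bayesActionValue_eq_actionValue hμ z
  -- With the belief frozen at `μ`, the Bayesian Bellman equation at `μ` is the ordinary one, so `W
  -- · μ` is its solution.
  refine ⟨fun s => W s μ, fun s => hval ▸ hW.2 s μ, fun z hz z' hzz' => ?_⟩
  rw [← hval]
  have hev : ∀ᶠ i in F, 0 < (f (β i)).1 z.state z.action := by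
    have h1 : Continuous fun g : Strategy D.Γ => g.1 z.state z.action :=
      (continuous_apply _).comp ((continuous_apply _).comp continuous_subtype_val)
    exact ((h1.tendsto σ).comp hσ).eventually (lt_mem_nhds hz)
  exact le_of_tendsto_of_tendsto
    (((hW.continuous_bayesActionValue hR hδ hδ1 z').tendsto μ).comp hβ)
    (((hW.continuous_bayesActionValue hR hδ hδ1 z).tendsto μ).comp hβ)
    (hev.mono fun i hi => hopt (β i) z hi z' hzz')

end SMDP

/-! ### Uniform sample averages and likelihood bounds -/

section Frequencies

variable {P : Type*} [Fintype P]

open Classical in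
/-- The frequency of `a` among the first `t` terms of the sequence `p`. -/
def seqFreq (p : ℕ → P) (t : ℕ) (a : P) : ℝ :=
  (∑ i ∈ Finset.range t, if p i = a then 1 else 0) / t

lemma sum_range_eq_seqFreq (p : ℕ → P) (t : ℕ) (φ : P → ℝ) :
    ∑ i ∈ Finset.range t, φ (p i) = t * ∑ a, seqFreq p t a * φ a := by
  classical
  rcases Nat.eq_zero_or_pos t with rfl | ht
  · simp
  have ht' : (t : ℝ) ≠ 0 := by positivity
  rw [Finset.mul_sum]
  have : ∀ a, (t : ℝ) * (seqFreq p t a * φ a)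
      = ∑ i ∈ Finset.range t, if p i = a then φ a else 0 := fun a => by
    rw [seqFreq, ← mul_assoc, mul_div_cancel₀ _ ht', Finset.sum_mul]
    exact Finset.sum_congr rfl fun i _ => by split_ifs <;> simp
  simp_rw [this]
  rw [Finset.sum_comm]
  simp

lemma abs_sum_range_sub_le (p : ℕ → P) (w : P → ℝ) (t : ℕ) {φ : P → ℝ} {C : ℝ}
    (hφ : ∀ a, |φ a| ≤ C) :
    |∑ i ∈ Finset.range t, φ (p i) - t * ∑ a, w a * φ a|
      ≤ t * (C * ∑ a, |seqFreq p t a - w a|) := by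
  rw [sum_range_eq_seqFreq, ← mul_sub, abs_mul, Nat.abs_cast, ← Finset.sum_sub_distrib,
    Finset.mul_sum]
  refine mul_le_mul_of_nonneg_left ((Finset.abs_sum_le_sum_abs _ _).trans
    (Finset.sum_le_sum fun a _ => ?_)) (Nat.cast_nonneg t)
  rw [← sub_mul, abs_mul, mul_comm]
  exact mul_le_mul_of_nonneg_right (hφ a) (abs_nonneg _)

/-- Sample averages converge uniformly over uniformly bounded functions on a finite set. -/
lemma eventually_abs_sum_range_sub_le {p : ℕ → P} {w : P → ℝ}
    (hw : ∀ a, Tendsto (fun t => seqFreq p t a) atTop (𝓝 (w a))) (C : ℝ) {ε : ℝ} (hε : 0 < ε) :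
    ∀ᶠ t : ℕ in atTop, ∀ φ : P → ℝ, (∀ a, |φ a| ≤ C) →
      |∑ i ∈ Finset.range t, φ (p i) - t * ∑ a, w a * φ a| ≤ t * ε := by
  have h0 : Tendsto (fun t => C * ∑ a, |seqFreq p t a - w a|) atTop (𝓝 0) := by
    have : Tendsto (fun t => C * ∑ a, |seqFreq p t a - w a|) atTop
        (𝓝 (C * ∑ a : P, |w a - w a|)) :=
      (tendsto_finsetSum _ fun a _ => ((hw a).sub_const (w a)).abs).const_mul C
    simpa using this
  filter_upwards [h0.eventually (gt_mem_nhds hε)] with t ht φ hφ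
  exact (abs_sum_range_sub_le p w t hφ).trans
    (mul_le_mul_of_nonneg_left ht.le (Nat.cast_nonneg t))

variable {T : Type*} [TopologicalSpace T] {q : T → P → ℝ}

/-- Truncating probabilities at `c` keeps their logarithms in `[log c, 0]`, uniformly in the
parameter, which uniform convergence of sample averages requires. -/
lemma abs_log_max_le {x c : ℝ} (hc : 0 < c) (hc1 : c ≤ 1) (hx : x ≤ 1) :
    |Real.log (max x c)| ≤ |Real.log c| := by
  rw [abs_of_nonpos (Real.log_nonpos (hc.le.trans (le_max_right _ _)) (max_le hx hc1)),
    abs_of_nonpos (Real.log_nonpos hc.le hc1)]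
  exact neg_le_neg (Real.log_le_log hc (le_max_right _ _))

lemma continuous_sum_log_max (hq : ∀ a, Continuous fun θ => q θ a) (w : P → ℝ) {c : ℝ}
    (hc : 0 < c) : Continuous fun θ => ∑ a, w a * Real.log (max (q θ a) c) :=
  continuous_finsetSum _ fun a _ => continuous_const.mul
    (((hq a).max continuous_const).log fun _ => (hc.trans_le (le_max_right _ _)).ne')

/-- Locally uniform upper bound for likelihoods of long samples. -/
lemma exists_isOpen_prod_le_exp (hq : ∀ a, Continuous fun θ => q θ a) (hq0 : ∀ θ a, 0 ≤ q θ a)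
    (hq1 : ∀ θ a, q θ a ≤ 1) {p : ℕ → P} {w : P → ℝ}
    (hw : ∀ a, Tendsto (fun t => seqFreq p t a) atTop (𝓝 (w a))) {θ₀ : T} {c r : ℝ} (hc : 0 < c)
    (hc1 : c ≤ 1) (hr : ∑ a, w a * Real.log (max (q θ₀ a) c) < r) :
    ∃ U : Set T, IsOpen U ∧ θ₀ ∈ U ∧ ∀ᶠ t : ℕ in atTop, ∀ θ ∈ U,
      ∏ i ∈ Finset.range t, q θ (p i) ≤ Real.exp (t * r) := by
  -- The neighborhood is cut out at level `r'`; the gap `r - r'` absorbs the sampling error.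
  obtain ⟨r', hr', hr'r⟩ := exists_between hr
  refine ⟨{θ | ∑ a, w a * Real.log (max (q θ a) c) < r'},
    isOpen_lt (continuous_sum_log_max hq w hc) continuous_const, hr', ?_⟩
  filter_upwards [eventually_abs_sum_range_sub_le hw |Real.log c| (sub_pos.2 hr'r)]
    with t ht θ hθ
  have hpos : ∀ a, 0 < max (q θ a) c := fun a => hc.trans_le (le_max_right _ _)
  calc ∏ i ∈ Finset.range t, q θ (p i) ≤ ∏ i ∈ Finset.range t, max (q θ (p i)) c :=
        Finset.prod_le_prod (fun i _ => hq0 θ _) fun i _ => le_max_left _ _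
    _ = Real.exp (∑ i ∈ Finset.range t, Real.log (max (q θ (p i)) c)) := by
        rw [Real.exp_sum]
        exact Finset.prod_congr rfl fun i _ => (Real.exp_log (hpos _)).symm
    _ ≤ Real.exp (t * r) := by
        refine Real.exp_le_exp.2 ?_
        have h1 := (abs_le.1 (ht (fun a => Real.log (max (q θ a) c))
          fun a => abs_log_max_le hc hc1 (hq1 θ a))).2
        have h2 := mul_le_mul_of_nonneg_left (le_of_lt hθ) (Nat.cast_nonneg (α := ℝ) t)
        nlinarith

/-- Locally uniform lower bound for likelihoods of long samples. -/
lemma exists_isOpen_exp_le_prod (hq : ∀ a, Continuous fun θ => q θ a)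
    (hq1 : ∀ θ a, q θ a ≤ 1) {p : ℕ → P} {w : P → ℝ}
    (hw : ∀ a, Tendsto (fun t => seqFreq p t a) atTop (𝓝 (w a))) {A : Set P} (hpA : ∀ i, p i ∈ A)
    (hwA : ∀ a, a ∉ A → w a = 0) {θ₁ : T} (hA : ∀ a ∈ A, 0 < q θ₁ a) {r : ℝ}
    (hr : r < ∑ a, w a * Real.log (q θ₁ a)) :
    ∃ U : Set T, IsOpen U ∧ θ₁ ∈ U ∧ ∀ᶠ t : ℕ in atTop, ∀ θ ∈ U,
      Real.exp (t * r) ≤ ∏ i ∈ Finset.range t, q θ (p i) := by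
  -- As `P` is finite, some `c` lies below every `q θ₁ a` with `a ∈ A`. Near `θ₁` truncation at this
  -- `c` leaves the likelihood of the sample unchanged.
  have hcex : ∀ᶠ c : ℝ in 𝓝[>] 0, ∀ a, a ∈ A → c < q θ₁ a := by
    refine eventually_all.2 fun a => ?_
    by_cases ha : a ∈ A
    · filter_upwards [(gt_mem_nhds (hA a ha)).filter_mono nhdsWithin_le_nhds] with c hc _ using hc
    · exact Eventually.of_forall fun c h => absurd h ha
  obtain ⟨c, hcA, hc, hc1⟩ := (hcex.and (Ioc_mem_nhdsGT (zero_lt_one' ℝ))).exists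
  obtain ⟨r', hr', hr'r⟩ := exists_between hr
  have hlog : ∑ a, w a * Real.log (max (q θ₁ a) c) = ∑ a, w a * Real.log (q θ₁ a) := by
    refine Finset.sum_congr rfl fun a _ => ?_
    by_cases ha : a ∈ A
    · rw [max_eq_left (hcA a ha).le]
    · rw [hwA a ha, zero_mul, zero_mul]
  refine ⟨{θ | ∀ a, a ∈ A → c < q θ a} ∩ {θ | r' < ∑ a, w a * Real.log (max (q θ a) c)},
    IsOpen.inter ?_ (isOpen_lt continuous_const (continuous_sum_log_max hq w hc)),
    ⟨hcA, by simpa only [Set.mem_ofPred_eq, hlog] using hr'r⟩, ?_⟩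
  · simp only [Set.ofPred_forall]
    exact isOpen_iInter_of_finite fun a => isOpen_iInter_of_finite fun _ =>
      isOpen_lt continuous_const (hq a)
  filter_upwards [eventually_abs_sum_range_sub_le hw |Real.log c| (sub_pos.2 hr')]
    with t ht θ hθ
  have hpos : ∀ i, c < q θ (p i) := fun i => hθ.1 _ (hpA i)
  calc Real.exp (t * r) ≤ Real.exp (∑ i ∈ Finset.range t, Real.log (max (q θ (p i)) c)) := by
        refine Real.exp_le_exp.2 ?_
        have h1 := (abs_le.1 (ht (fun a => Real.log (max (q θ a) c))
          fun a => abs_log_max_le hc hc1 (hq1 θ a))).1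
        have h2 := mul_le_mul_of_nonneg_left (le_of_lt hθ.2) (Nat.cast_nonneg (α := ℝ) t)
        nlinarith
    _ = ∏ i ∈ Finset.range t, q θ (p i) := by
        rw [Real.exp_sum]
        exact Finset.prod_congr rfl fun i _ => by
          rw [max_eq_left (hpos i).le, Real.exp_log (hc.trans (hpos i))]

end Frequencies

/-! ### Concentration of beliefs on the closest parameters -/

namespace SMDP

variable {S X : Type*} [Fintype S] [Fintype X] {d : ℕ} {Θ : Set (EuclideanSpace ℝ (Fin d))}
  {D : SMDP S X Θ}

variable (D) in
/-- The likelihood of the first `t` transitions of the history `h` under the model `θ`. -/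
def likelihood (h : ℕ → Gr D.Γ) (t : ℕ) (θ : Θ) : ℝ :=
  ∏ i ∈ Finset.range t, (D.model θ (h i)).1 (h (i + 1)).state

lemma likelihood_nonneg (h : ℕ → Gr D.Γ) (t : ℕ) (θ : Θ) : 0 ≤ D.likelihood h t θ :=
  Finset.prod_nonneg fun _ _ => model_nonneg _ _ _

lemma likelihood_le_one (h : ℕ → Gr D.Γ) (t : ℕ) (θ : Θ) : D.likelihood h t θ ≤ 1 :=
  Finset.prod_le_one (fun _ _ => model_nonneg _ _ _) fun _ _ => model_le_one _ _ _

lemma continuous_likelihood (hR : D.Regular) (h : ℕ → Gr D.Γ) (t : ℕ) :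
    Continuous (D.likelihood h t) :=
  continuous_finsetProd _ fun _ _ => hR.continuous _ _

lemma integrable_likelihood (hR : D.Regular) (μ : ProbabilityMeasure Θ) (h : ℕ → Gr D.Γ) (t : ℕ) :
    Integrable (D.likelihood h t) (μ : Measure Θ) :=
  Integrable.of_bound (continuous_likelihood hR h t).measurable.aestronglyMeasurable 1
    (ae_of_all _ fun θ => by
      rw [Real.norm_of_nonneg (likelihood_nonneg h t θ)]; exact likelihood_le_one h t θ)

/-- Beliefs are the prior reweighted by the likelihood of the observed transitions. -/
lemma integral_belief (hR : D.Regular) (μ₀ : ProbabilityMeasure Θ) {h : ℕ → Gr D.Γ}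
    (hpos : ∀ t, 0 < ∫ θ, D.likelihood h t θ ∂(μ₀ : Measure Θ)) (t : ℕ) (g : Θ → ℝ) :
    ∫ θ, g θ ∂(D.belief μ₀ h t : Measure Θ)
      = (∫ θ, D.likelihood h t θ ∂(μ₀ : Measure Θ))⁻¹
        * ∫ θ, g θ * D.likelihood h t θ ∂(μ₀ : Measure Θ) := by
  induction t generalizing g with
  | zero => simp [belief, likelihood]
  | succ t ih =>
    have hmul : ∀ θ, (D.model θ (h t)).1 (h (t + 1)).state * D.likelihood h t θ
        = D.likelihood h (t + 1) θ := fun θ => by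
      rw [likelihood, likelihood, Finset.prod_range_succ, mul_comm]
    have hQ : D.Qbar (D.belief μ₀ h t) (h t) (h (t + 1)).state
        = (∫ θ, D.likelihood h t θ ∂(μ₀ : Measure Θ))⁻¹
          * ∫ θ, D.likelihood h (t + 1) θ ∂(μ₀ : Measure Θ) := by
      rw [Qbar, ih]; simp_rw [hmul]
    -- Every update is thus a genuine posterior, never the default branch of `bayes`; the
    -- normalizing constants then telescope.
    have hQpos : 0 < D.Qbar (D.belief μ₀ h t) (h t) (h (t + 1)).state := by
      rw [hQ]; exact mul_pos (inv_pos.2 (hpos t)) (hpos (t + 1))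
    rw [belief, integral_bayes hR hQpos, ih, hQ]
    simp_rw [mul_assoc, hmul]
    rw [mul_inv, inv_inv, mul_comm (∫ θ, D.likelihood h t θ ∂(μ₀ : Measure Θ)), mul_assoc,
      mul_inv_cancel_left₀ (hpos t).ne']

/-- The weight `m(s, x) Q(s' ∣ s, x)` of a transition. -/
def transitionWeight (D : SMDP S X Θ) (m : OutcomeDist D.Γ) (a : Gr D.Γ × S) : ℝ :=
  m.1 a.1 * (D.Q a.1).1 a.2

lemma transitionWeight_nonneg (m : OutcomeDist D.Γ) (a : Gr D.Γ × S) :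
    0 ≤ D.transitionWeight m a := mul_nonneg (m.2.1 _) ((D.Q _).2.1 _)

lemma mul_klTerm_of_pos {m x y : ℝ} (hy : 0 < m * x → 0 < y) (hm : 0 ≤ m) (hx : 0 ≤ x) :
    (m : EReal) * klTerm x y = ((m * x * (Real.log x - Real.log y) : ℝ) : EReal) := by
  unfold klTerm
  rcases hm.eq_or_lt with rfl | hm
  · simp
  rcases hx.eq_or_lt with rfl | hx
  · simp
  have := hy (mul_pos hm hx)
  rw [if_neg hx.ne', if_neg this.ne', Real.log_div hx.ne' this.ne', ← EReal.coe_mul, mul_assoc]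

lemma _root_.EReal.mul_sum_of_nonneg {ι : Type*} (I : Finset ι) {x : ℝ} (hx : 0 ≤ x)
    (g : ι → EReal) : (x : EReal) * ∑ i ∈ I, g i = ∑ i ∈ I, (x : EReal) * g i := by
  classical
  induction I using Finset.induction_on with
  | empty => simp
  | insert i I hi ih =>
    rw [Finset.sum_insert hi, Finset.sum_insert hi, EReal.left_distrib_of_nonneg_of_ne_top
      (EReal.coe_nonneg.2 hx) (EReal.coe_ne_top x), ih]

lemma _root_.EReal.coe_sum {ι : Type*} (I : Finset ι) (g : ι → ℝ) :
    ((∑ i ∈ I, g i : ℝ) : EReal) = ∑ i ∈ I, (g i : EReal) := by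
  classical
  induction I using Finset.induction_on with
  | empty => simp
  | insert i I hi ih => rw [Finset.sum_insert hi, Finset.sum_insert hi, EReal.coe_add, ih]

lemma _root_.EReal.sum_ne_bot {ι : Type*} (I : Finset ι) {g : ι → EReal}
    (hg : ∀ i, g i ≠ ⊥) : ∑ i ∈ I, g i ≠ ⊥ := by
  classical
  induction I using Finset.induction_on with
  | empty => simp
  | insert i I hi ih =>
    rw [Finset.sum_insert hi, Ne, EReal.add_eq_bot_iff, not_or]
    exact ⟨hg i, ih⟩

lemma wKLD_eq (m : OutcomeDist D.Γ) (θ : Θ) :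
    D.wKLD m θ = ∑ a : Gr D.Γ × S,
      (m.1 a.1 : EReal) * klTerm ((D.Q a.1).1 a.2) ((D.model θ a.1).1 a.2) := by
  rw [Fintype.sum_prod_type]
  exact Finset.sum_congr rfl fun z _ => EReal.mul_sum_of_nonneg _ (m.2.1 z) _

/-- The first sum does not involve `θ`, so among such models a smaller divergence means a larger
expected log-likelihood. -/
lemma wKLD_of_pos {m : OutcomeDist D.Γ} {θ : Θ}
    (h : ∀ a : Gr D.Γ × S, 0 < D.transitionWeight m a → 0 < (D.model θ a.1).1 a.2) :
    D.wKLD m θ = ((∑ a : Gr D.Γ × S, D.transitionWeight m a * Real.log ((D.Q a.1).1 a.2)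
      - ∑ a : Gr D.Γ × S, D.transitionWeight m a * Real.log ((D.model θ a.1).1 a.2) : ℝ) :
        EReal) := by
  rw [wKLD_eq, ← Finset.sum_sub_distrib]
  rw [Finset.sum_congr rfl fun a _ =>
    mul_klTerm_of_pos (h a) (m.2.1 a.1) ((D.Q a.1).2.1 a.2), ← EReal.coe_sum]
  exact congrArg _ (Finset.sum_congr rfl fun a _ => by rw [transitionWeight, mul_sub])

/-- In `EReal`, `⊤ + ⊥ = ⊥`; one infinite term makes the divergence infinite only because no other
term is `⊥`. -/
lemma mul_klTerm_ne_bot {m x y : ℝ} (hm : 0 ≤ m) : (m : EReal) * klTerm x y ≠ ⊥ := by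
  rcases hm.eq_or_lt with rfl | hm
  · simp
  · unfold klTerm
    split_ifs
    · simp
    · rw [EReal.coe_mul_top_of_pos hm]; exact top_ne_bot
    · rw [← EReal.coe_mul]; exact EReal.coe_ne_bot _

lemma wKLD_eq_top {m : OutcomeDist D.Γ} {θ : Θ} {a : Gr D.Γ × S}
    (ha : 0 < D.transitionWeight m a) (h : (D.model θ a.1).1 a.2 = 0) : D.wKLD m θ = ⊤ := by
  classical
  have hm : 0 < m.1 a.1 := pos_of_mul_pos_left ha ((D.Q a.1).2.1 a.2)
  have hQ : 0 < (D.Q a.1).1 a.2 := pos_of_mul_pos_right ha (m.2.1 a.1)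
  rw [wKLD_eq, ← Finset.add_sum_erase _ _ (Finset.mem_univ a), klTerm, if_neg hQ.ne', if_pos h,
    EReal.coe_mul_top_of_pos hm]
  exact EReal.top_add_of_ne_bot (EReal.sum_ne_bot _ fun b => mul_klTerm_ne_bot (m.2.1 b.1))

/-- A model whose divergence is not minimal has a truncated cross-entropy bound that separates it
from a model that dominates the true transitions. -/
lemma exists_separation (hR : D.Regular) {m : OutcomeDist D.Γ} {θ₀ : Θ} (h : θ₀ ∉ D.closest m) :
    ∃ (θ₁ : Θ) (c r₀ r₁ : ℝ), 0 < c ∧ c ≤ 1 ∧ r₀ < r₁ ∧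
      (∀ a : Gr D.Γ × S, 0 < (D.Q a.1).1 a.2 → 0 < (D.model θ₁ a.1).1 a.2) ∧
      ∑ a : Gr D.Γ × S, D.transitionWeight m a * Real.log (max ((D.model θ₀ a.1).1 a.2) c) < r₀ ∧
      r₁ < ∑ a : Gr D.Γ × S, D.transitionWeight m a * Real.log ((D.model θ₁ a.1).1 a.2) := by
  set w := D.transitionWeight m with hw
  have hw0 : ∀ a, 0 ≤ w a := transitionWeight_nonneg m
  simp only [closest, Set.mem_ofPred_eq, not_forall, not_le] at h
  obtain ⟨θ', hθ'⟩ := h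
  have hpos' : ∀ a : Gr D.Γ × S, 0 < w a → 0 < (D.model θ' a.1).1 a.2 := fun a ha => by
    refine (model_nonneg θ' a.1 a.2).lt_of_ne fun h0 => ?_
    rw [wKLD_eq_top ha h0.symm] at hθ'
    exact not_top_lt hθ'
  obtain ⟨c, hc, hc1, hlt⟩ : ∃ c : ℝ, 0 < c ∧ c ≤ 1 ∧
      ∑ a, w a * Real.log (max ((D.model θ₀ a.1).1 a.2) c)
        < ∑ a, w a * Real.log ((D.model θ' a.1).1 a.2) := by
    suffices hev : ∀ᶠ c : ℝ in 𝓝[>] 0, ∑ a, w a * Real.log (max ((D.model θ₀ a.1).1 a.2) c)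
        < ∑ a, w a * Real.log ((D.model θ' a.1).1 a.2) by
      obtain ⟨c, h1, h2⟩ := (hev.and (Ioc_mem_nhdsGT (zero_lt_one' ℝ))).exists
      exact ⟨c, h2.1, h2.2, h1⟩
    -- If the divergence of `θ₀` is finite, the truncated sum tends to the untruncated one as `c`
    -- decreases to zero. Otherwise some transition of positive weight is impossible under `θ₀`; its
    -- term `w b * log c` tends to `-∞`, while the others are nonpositive.
    by_cases hpos : ∀ a : Gr D.Γ × S, 0 < w a → 0 < (D.model θ₀ a.1).1 a.2
    · rw [wKLD_of_pos hpos', wKLD_of_pos hpos, EReal.coe_lt_coe_iff] at hθ'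
      have htend : Tendsto (fun c : ℝ => ∑ a, w a * Real.log (max ((D.model θ₀ a.1).1 a.2) c))
          (𝓝[>] 0) (𝓝 (∑ a, w a * Real.log ((D.model θ₀ a.1).1 a.2))) := by
        refine tendsto_finsetSum _ fun a _ => ?_
        rcases (hw0 a).eq_or_lt with h0 | h0
        · simp [← h0]
        refine (Tendsto.log ?_ (hpos a h0).ne').const_mul _
        have : Tendsto (fun c : ℝ => max ((D.model θ₀ a.1).1 a.2) c) (𝓝 0)
            (𝓝 (max ((D.model θ₀ a.1).1 a.2) 0)) :=
          (continuous_const.max continuous_id).tendsto 0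
        rw [max_eq_left (model_nonneg _ _ _)] at this
        exact this.mono_left nhdsWithin_le_nhds
      exact htend.eventually (gt_mem_nhds (by linarith))
    · push Not at hpos
      obtain ⟨b, hb, hb0⟩ := hpos
      have hb0 : (D.model θ₀ b.1).1 b.2 = 0 := le_antisymm hb0 (model_nonneg _ _ _)
      have hbot : Tendsto (fun c : ℝ => w b * Real.log c) (𝓝[>] 0) atBot :=
        Real.tendsto_log_nhdsGT_zero.const_mul_atBot hb
      filter_upwards [hbot.eventually (eventually_lt_atBot _), Ioc_mem_nhdsGT (zero_lt_one' ℝ)]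
        with c hc1 hc
      refine lt_of_le_of_lt ?_ hc1
      classical
      rw [← Finset.add_sum_erase _ _ (Finset.mem_univ b), hb0, max_eq_right hc.1.le]
      exact add_le_of_nonpos_right (Finset.sum_nonpos fun a _ =>
        mul_nonpos_of_nonneg_of_nonpos (hw0 a) (Real.log_nonpos
          (hc.1.le.trans (le_max_right _ _)) (max_le (model_le_one _ _ _) hc.2)))
  have hopen : ∀ᶠ θ in 𝓝 θ', ∑ a, w a * Real.log (max ((D.model θ₀ a.1).1 a.2) c)
      < ∑ a, w a * Real.log ((D.model θ a.1).1 a.2) := by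
    have htend : Tendsto (fun θ => ∑ a, w a * Real.log ((D.model θ a.1).1 a.2)) (𝓝 θ')
        (𝓝 (∑ a, w a * Real.log ((D.model θ' a.1).1 a.2))) := by
      refine tendsto_finsetSum _ fun a _ => ?_
      rcases (hw0 a).eq_or_lt with h0 | h0
      · simp [← h0]
      exact (((hR.continuous a.1 a.2).tendsto θ').log (hpos' a h0).ne').const_mul _
    exact htend.eventually (lt_mem_nhds hlt)
  -- The model `θ'` may exclude a true transition of zero weight, and a single occurrence would
  -- annihilate its likelihood. The inequality is open, so `θ'` can be moved into the dense set of
  -- dominating models.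
  obtain ⟨A, hA, hApos⟩ := hR.dense
  obtain ⟨θ₁, hθ₁A, hθ₁⟩ := (hA.inter_nhds_nonempty hopen)
  rw [Set.mem_ofPred_eq] at hθ₁
  obtain ⟨r₀, hr₀, hr₀'⟩ := exists_between hθ₁
  obtain ⟨r₁, hr₁, hr₁'⟩ := exists_between hr₀'
  exact ⟨θ₁, c, r₀, r₁, hc, hc1, hr₁, fun a ha => hApos θ₁ hθ₁A a.1 a.2 ha, hr₀, hr₁'⟩

/-- A dominating model gives the sample positive likelihood; by continuity so does a neighborhood of
it, which the prior charges. -/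
lemma integral_likelihood_pos (hR : D.Regular) {μ₀ : ProbabilityMeasure Θ} (hμ₀ : FullSupport μ₀)
    {h : ℕ → Gr D.Γ} (hQ : ∀ t, 0 < (D.Q (h t)).1 (h (t + 1)).state) (t : ℕ) :
    0 < ∫ θ, D.likelihood h t θ ∂(μ₀ : Measure Θ) := by
  rw [integral_pos_iff_support_of_nonneg (likelihood_nonneg h t) (integrable_likelihood hR μ₀ h t)]
  have hne : Nonempty Θ := D.Θ_nonempty.to_subtype
  obtain ⟨A, hA, hApos⟩ := hR.dense
  obtain ⟨θ, hθ⟩ := hA.nonempty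
  exact hμ₀ _ (continuous_likelihood hR h t).isOpen_support
    ⟨θ, (Finset.prod_pos fun i _ => hApos θ hθ _ _ (hQ i)).ne'⟩

/-- Along a history with convergent transition frequencies, beliefs vanish in a neighborhood of each
parameter that is not closest to the truth. -/
lemma exists_isOpen_belief_tendsto_zero (hR : D.Regular) {μ₀ : ProbabilityMeasure Θ}
    (hμ₀ : FullSupport μ₀) {h : ℕ → Gr D.Γ}
    (hQ : ∀ t, 0 < (D.Q (h t)).1 (h (t + 1)).state) {m : OutcomeDist D.Γ}
    (hfreq : ∀ a, Tendsto (fun t => seqFreq (fun i => (h i, (h (i + 1)).state)) t a) atTop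
      (𝓝 (D.transitionWeight m a))) {θ₀ : Θ} (hθ₀ : θ₀ ∉ D.closest m) :
    ∃ U : Set Θ, IsOpen U ∧ θ₀ ∈ U ∧
      Tendsto (fun t => (D.belief μ₀ h t : Measure Θ).real U) atTop (𝓝 0) := by
  obtain ⟨θ₁, c, r₀, r₁, hc, hc1, hr, hθ₁, hlt₀, hlt₁⟩ := exists_separation hR hθ₀
  have hq : ∀ a : Gr D.Γ × S, Continuous fun θ => (D.model θ a.1).1 a.2 :=
    fun a => hR.continuous a.1 a.2
  obtain ⟨U, hU, hθ₀U, hUle⟩ := exists_isOpen_prod_le_exp (q := fun θ (a : Gr D.Γ × S) =>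
    (D.model θ a.1).1 a.2) hq (fun θ a => model_nonneg θ a.1 a.2)
    (fun θ a => model_le_one θ a.1 a.2) hfreq hc hc1 hlt₀
  obtain ⟨V, hV, hθ₁V, hVle⟩ := exists_isOpen_exp_le_prod (q := fun θ (a : Gr D.Γ × S) =>
    (D.model θ a.1).1 a.2) hq (fun θ a => model_le_one θ a.1 a.2) hfreq
    (A := {a | 0 < (D.Q a.1).1 a.2}) hQ (fun a ha => by
      rw [transitionWeight, le_antisymm (not_lt.1 ha) ((D.Q a.1).2.1 a.2), mul_zero]) hθ₁ hlt₁
  have hVpos : 0 < (μ₀ : Measure Θ).real V :=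
    ENNReal.toReal_pos (hμ₀ V hV ⟨θ₁, hθ₁V⟩).ne' (measure_ne_top _ _)
  refine ⟨U, hU, hθ₀U, ?_⟩
  have hbound : Tendsto (fun t : ℕ => ((μ₀ : Measure Θ).real V)⁻¹ * Real.exp (t * (r₀ - r₁)))
      atTop (𝓝 0) := by
    have h1 : Tendsto (fun t : ℕ => (t : ℝ) * (r₀ - r₁)) atTop atBot :=
      tendsto_natCast_atTop_atTop.atTop_mul_const_of_neg (sub_neg.2 hr)
    simpa using (Real.tendsto_exp_atBot.comp h1).const_mul ((μ₀ : Measure Θ).real V)⁻¹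
  refine squeeze_zero' (Eventually.of_forall fun t => measureReal_nonneg) ?_ hbound
  have hpos := integral_likelihood_pos hR hμ₀ hQ
  filter_upwards [hUle, hVle] with t htU htV
  have hint := integrable_likelihood hR μ₀ h t
  -- The normalizing constant is bounded below by the contribution of `V` alone.
  have hden : Real.exp (t * r₁) * (μ₀ : Measure Θ).real V
      ≤ ∫ θ, D.likelihood h t θ ∂(μ₀ : Measure Θ) := by
    refine le_trans ?_ (setIntegral_le_integral (s := V) hint
      (ae_of_all _ (likelihood_nonneg h t)))
    rw [mul_comm]
    refine le_trans (le_of_eq ?_) (setIntegral_mono_on (f := fun _ => Real.exp (t * r₁))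
      integrableOn_const hint.integrableOn hV.measurableSet htV)
    simp
  have hnum : ∫ θ in U, D.likelihood h t θ ∂(μ₀ : Measure Θ) ≤ Real.exp (t * r₀) := by
    refine (setIntegral_mono_on (g := fun _ => Real.exp (t * r₀)) hint.integrableOn
      integrableOn_const hU.measurableSet htU).trans ?_
    simp only [setIntegral_const, smul_eq_mul]
    exact mul_le_of_le_one_left (Real.exp_pos _).le measureReal_le_one
  have hbel := integral_belief hR μ₀ hpos t (U.indicator 1)
  rw [integral_indicator_one hU.measurableSet] at hbel
  have hind : ∫ θ, U.indicator 1 θ * D.likelihood h t θ ∂(μ₀ : Measure Θ)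
      = ∫ θ in U, D.likelihood h t θ ∂(μ₀ : Measure Θ) := by
    rw [← integral_indicator hU.measurableSet]
    refine integral_congr_ae (ae_of_all _ fun θ => ?_)
    by_cases hθ : θ ∈ U <;> simp [hθ]
  rw [hbel, hind, ← div_eq_inv_mul, ← div_eq_inv_mul]
  calc (∫ θ in U, D.likelihood h t θ ∂(μ₀ : Measure Θ)) / ∫ θ, D.likelihood h t θ ∂(μ₀ : Measure Θ)
      ≤ Real.exp (t * r₀) / (Real.exp (t * r₁) * (μ₀ : Measure Θ).real V) := by
        gcongr
    _ = Real.exp (t * (r₀ - r₁)) / (μ₀ : Measure Θ).real V := by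
        rw [mul_sub, Real.exp_sub, div_div]

/-- Limit beliefs are concentrated on the closest parameter values. -/
lemma ae_mem_closest_of_tendsto (hR : D.Regular) {μ₀ : ProbabilityMeasure Θ}
    (hμ₀ : FullSupport μ₀) {h : ℕ → Gr D.Γ}
    (hQ : ∀ t, 0 < (D.Q (h t)).1 (h (t + 1)).state) {m : OutcomeDist D.Γ}
    (hfreq : ∀ a, Tendsto (fun t => seqFreq (fun i => (h i, (h (i + 1)).state)) t a) atTop
      (𝓝 (D.transitionWeight m a))) {F : Filter ℕ} [F.NeBot] (hF : F ≤ atTop)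
    {μ : ProbabilityMeasure Θ} (hμ : Tendsto (D.belief μ₀ h) F (𝓝 μ)) :
    ∀ᵐ θ ∂(μ : Measure Θ), θ ∈ D.closest m := by
  -- By second countability of `Θ` it is enough to find a null neighborhood of each non-minimizer;
  -- the portmanteau inequality for open sets supplies it.
  refine measure_null_of_locally_null _ fun θ₀ hθ₀ => ?_
  obtain ⟨U, hU, hθ₀U, hlim⟩ := exists_isOpen_belief_tendsto_zero hR hμ₀ hQ hfreq hθ₀
  refine ⟨U, mem_nhdsWithin_of_mem_nhds (hU.mem_nhds hθ₀U), le_antisymm ?_ zero_le⟩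
  refine (ProbabilityMeasure.le_liminf_measure_open_of_tendsto hμ hU).trans (le_of_eq ?_)
  have hlim' : Tendsto (fun t => (D.belief μ₀ h t : Measure Θ) U) F (𝓝 0) := by
    have := ENNReal.tendsto_ofReal (hlim.mono_left hF)
    simpa [Measure.real, ENNReal.ofReal_toReal (measure_ne_top _ _)] using this
  exact hlim'.liminf_eq

end SMDP

/-! ### A strong law of large numbers from second moments -/

/-- A sequence with bounded increments whose averages vanish along the squares has vanishing
averages. -/
lemma tendsto_sum_div_of_tendsto_sq {x : ℕ → ℝ} (hx : ∀ i, |x i| ≤ 1)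
    (h : Tendsto (fun k : ℕ => (∑ i ∈ Finset.range ((k + 1) ^ 2), x i) / ((k + 1) ^ 2 : ℕ)) atTop
      (𝓝 0)) :
    Tendsto (fun n : ℕ => (∑ i ∈ Finset.range n, x i) / n) atTop (𝓝 0) := by
  -- Since `x i ≥ -1`, adding `n` makes the partial sums monotone, which controls the averages
  -- between consecutive squares.
  set u : ℕ → ℝ := fun n => ∑ i ∈ Finset.range n, x i + n with hu
  have hmono : Monotone u := monotone_nat_of_le_succ fun n => by
    simp only [hu, Finset.sum_range_succ, Nat.cast_succ]
    linarith [(abs_le.1 (hx n)).1]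
  have hlim : Tendsto (fun n => u n / n) atTop (𝓝 1) := by
    refine tendsto_div_of_monotone_of_exists_subseq_tendsto_div u 1 hmono fun a ha =>
      ⟨fun k => (k + 1) ^ 2, ?_, ?_, ?_⟩
    -- The ratio of consecutive squares is eventually below `a`: `k * (a - 1) ≥ 3` gives `(k + 2) ^
    -- 2 ≤ a * (k + 1) ^ 2`.
    · filter_upwards [eventually_ge_atTop ⌈3 / (a - 1)⌉₊] with k hk
      have h1 : 3 / (a - 1) ≤ (k : ℝ) := (Nat.le_ceil _).trans (by exact_mod_cast hk)
      rw [div_le_iff₀ (sub_pos.2 ha)] at h1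
      push_cast
      nlinarith [Nat.cast_nonneg (α := ℝ) k]
    · exact (tendsto_pow_atTop two_ne_zero).comp (tendsto_add_atTop_nat 1)
    · have := h.add_const 1
      rw [zero_add] at this
      refine this.congr fun k => ?_
      have hk : (((k + 1) ^ 2 : ℕ) : ℝ) ≠ 0 := by positivity
      simp only [hu]
      rw [add_div, div_self hk]
  have := hlim.sub_const 1
  rw [sub_self] at this
  refine this.congr' ?_
  filter_upwards [eventually_gt_atTop 0] with n hn
  have hn' : (n : ℝ) ≠ 0 := by positivity
  simp only [hu]
  rw [add_div, div_self hn', add_sub_cancel_right]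

/-- A strong law of large numbers under a linear bound on the second moments of partial sums. -/
lemma ae_tendsto_sum_div_of_integral_sq_le {Ω : Type*} [MeasurableSpace Ω] {ρ : Measure Ω}
    [IsProbabilityMeasure ρ] {x : ℕ → Ω → ℝ} (hm : ∀ i, Measurable (x i))
    (hx : ∀ i ω, |x i ω| ≤ 1)
    (hsq : ∀ n : ℕ, ∫ ω, (∑ i ∈ Finset.range n, x i ω) ^ 2 ∂ρ ≤ n) :
    ∀ᵐ ω ∂ρ, Tendsto (fun n : ℕ => (∑ i ∈ Finset.range n, x i ω) / n) atTop (𝓝 0) := by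
  have hmS : ∀ n, Measurable fun ω => ∑ i ∈ Finset.range n, x i ω := fun n =>
    Finset.measurable_fun_sum _ fun i _ => hm i
  -- The mean square of the average of `n` terms is at most `1 / n`, which is summable along the
  -- squares.
  set y : ℕ → Ω → ENNReal := fun k ω => ENNReal.ofReal
    (((∑ i ∈ Finset.range ((k + 1) ^ 2), x i ω) / ((k + 1) ^ 2 : ℕ)) ^ 2) with hy
  have hmy : ∀ k, Measurable (y k) := fun k =>
    (((hmS _).div_const _).pow_const 2).ennreal_ofReal
  have hle : ∀ k : ℕ, ∫⁻ ω, y k ω ∂ρ ≤ ENNReal.ofReal (1 / ((k + 1 : ℕ) : ℝ) ^ 2) := fun k => by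
    have hint : Integrable (fun ω => ((∑ i ∈ Finset.range ((k + 1) ^ 2), x i ω) /
        ((k + 1) ^ 2 : ℕ)) ^ 2) ρ := by
      refine Integrable.of_bound (((hmS _).div_const _).pow_const 2).aestronglyMeasurable 1
        (ae_of_all _ fun ω => ?_)
      rw [Real.norm_eq_abs, abs_pow, abs_div, Nat.abs_cast]
      refine pow_le_one₀ (by positivity) (div_le_one_of_le₀ ?_ (Nat.cast_nonneg _))
      refine (Finset.abs_sum_le_sum_abs _ _).trans ((Finset.sum_le_sum fun i _ => hx i ω).trans ?_)
      simp
    rw [hy, ← ofReal_integral_eq_lintegral_ofReal hint (ae_of_all _ fun ω => sq_nonneg _)]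
    refine ENNReal.ofReal_le_ofReal ?_
    simp_rw [div_pow]
    rw [integral_div, div_le_div_iff₀ (by positivity) (by positivity)]
    have := hsq ((k + 1) ^ 2)
    push_cast at this ⊢
    nlinarith [sq_nonneg ((k : ℝ) + 1)]
  have hsum : ∫⁻ ω, ∑' k, y k ω ∂ρ ≠ ⊤ := by
    rw [lintegral_tsum fun k => (hmy k).aemeasurable]
    refine ne_top_of_le_ne_top ?_ (ENNReal.tsum_le_tsum hle)
    have hs : Summable fun k : ℕ => 1 / ((k + 1 : ℕ) : ℝ) ^ 2 :=
      (summable_nat_add_iff 1).2 (Real.summable_one_div_nat_pow.2 one_lt_two)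
    exact hs.tsum_ofReal_ne_top
  filter_upwards [ae_lt_top (Measurable.tsum hmy) hsum] with ω hω
  refine tendsto_sum_div_of_tendsto_sq (fun i => hx i ω) ?_
  have h0 := ENNReal.tendsto_atTop_zero_of_tsum_ne_top hω.ne
  have h1 := (ENNReal.tendsto_toReal ENNReal.zero_ne_top).comp h0
  have h2 := h1.sqrt
  refine squeeze_zero_norm' (Eventually.of_forall fun k => ?_)
    (by simpa using h2)
  simp only [hy]
  rw [ENNReal.toReal_ofReal (sq_nonneg _), Real.sqrt_sq_eq_abs, Real.norm_eq_abs]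

lemma integral_outcomeLaw {S X : Type*} [Fintype S] [Fintype X] {Γ : S → Finset X}
    (p : stdSimplex ℝ S) (g : Strategy Γ) (φ : Gr Γ → ℝ) :
    ∫ z, φ z ∂outcomeLaw p g = ∑ z, p.1 z.state * g.1 z.state z.action * φ z := by
  have hfin : ∀ z : Gr Γ, IsFiniteMeasure
      (ENNReal.ofReal (p.1 z.state * g.1 z.state z.action) • Measure.dirac z) :=
    fun z => (Measure.dirac z).smul_finite ENNReal.ofReal_ne_top
  rw [outcomeLaw, integral_finsetSum_measure fun z _ => Integrable.of_finite]
  refine Finset.sum_congr rfl fun z _ => ?_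
  rw [integral_smul_measure, integral_dirac, ENNReal.toReal_ofReal
    (mul_nonneg (p.2.1 _) ((g.2 _).1.1 _)), smul_eq_mul]

/-- The marginal distribution of the state under `outcomeLaw`. -/
lemma sum_outcome_weights_state {S X : Type*} [Fintype S] [Fintype X] {Γ : S → Finset X}
    (p : stdSimplex ℝ S) (g : Strategy Γ) (φ : S → ℝ) :
    ∑ z : Gr Γ, p.1 z.state * g.1 z.state z.action * φ z.state = ∑ s, p.1 s * φ s := by
  classical
  have h1 : ∑ z : Gr Γ, p.1 z.state * g.1 z.state z.action * φ z.state
      = ∑ a ∈ (Finset.univ : Finset (S × X)).filter (fun a => a.2 ∈ Γ a.1),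
          p.1 a.1 * g.1 a.1 a.2 * φ a.1 := by
    rw [Finset.sum_subtype (p := fun a : S × X => a.2 ∈ Γ a.1) (F := inferInstance)]
    · exact Finset.sum_congr rfl fun _ _ => rfl
    · simp
  rw [h1, Finset.sum_filter_of_ne, Fintype.sum_prod_type]
  · refine Finset.sum_congr rfl fun s _ => ?_
    dsimp only
    rw [← Finset.sum_mul, ← Finset.mul_sum, (g.2 s).1.2, mul_one]
  · intro a _ ha
    by_contra hn
    exact ha (by rw [(g.2 a.1).2 _ hn, mul_zero, zero_mul])

/-! ### Martingale differences of the history process -/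

namespace SMDP

variable {S X : Type*} [Fintype S] [Fintype X] {d : ℕ} {Θ : Set (EuclideanSpace ℝ (Fin d))}
  {D : SMDP S X Θ}

lemma belief_congr (μ₀ : ProbabilityMeasure Θ) {h h' : ℕ → Gr D.Γ} {t : ℕ}
    (hh : ∀ i ≤ t, h i = h' i) : D.belief μ₀ h t = D.belief μ₀ h' t := by
  induction t with
  | zero => rfl
  | succ t ih =>
    rw [belief, belief, ih fun i hi => hh i (hi.trans t.le_succ), hh t t.le_succ, hh (t + 1) le_rfl]

lemma extend_frestrictLe (h : ℕ → Gr D.Γ) {t i : ℕ} (hi : i ≤ t) :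
    D.extend (Preorder.frestrictLe (π := fun _ => Gr D.Γ) t h) i = h i := by
  simp [extend, Preorder.frestrictLe, hi]

/-- Factoring through the finite space of histories up to `t` makes measurability and integrability
automatic, although the policy function need not be measurable. -/
lemma exists_eq_comp_frestrictLe {Y : (ℕ → Gr D.Γ) → ℝ} {t : ℕ} (hY : DependsOn Y (Set.Iic t)) :
    Y = (fun u => Y (D.extend u)) ∘ Preorder.frestrictLe (π := fun _ => Gr D.Γ) t :=
  funext fun h => hY fun _ hi => (extend_frestrictLe h hi).symm

lemma measurable_of_dependsOn {Y : (ℕ → Gr D.Γ) → ℝ} {t : ℕ} (hY : DependsOn Y (Set.Iic t)) :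
    Measurable Y := by
  rw [exists_eq_comp_frestrictLe hY]
  exact (measurable_of_countable _).comp (by fun_prop)

instance (μ₀ : ProbabilityMeasure Θ) (f : ProbabilityMeasure Θ → Strategy D.Γ) :
    IsProbabilityMeasure (D.historyLaw μ₀ f) :=
  inferInstanceAs (IsProbabilityMeasure (Kernel.trajMeasure (X := fun _ => Gr D.Γ) _ _))

lemma integrable_of_dependsOn (μ₀ : ProbabilityMeasure Θ)
    (f : ProbabilityMeasure Θ → Strategy D.Γ) {Y : (ℕ → Gr D.Γ) → ℝ} {t : ℕ}
    (hY : DependsOn Y (Set.Iic t)) : Integrable Y (D.historyLaw μ₀ f) := by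
  rw [exists_eq_comp_frestrictLe hY]
  exact Integrable.comp_measurable Integrable.of_finite (by fun_prop)

/-- The conditional law of the outcome of period `t + 1` after the history `h`. -/
def nextLaw (D : SMDP S X Θ) (μ₀ : ProbabilityMeasure Θ)
    (f : ProbabilityMeasure Θ → Strategy D.Γ) (t : ℕ) (h : ℕ → Gr D.Γ) : Measure (Gr D.Γ) :=
  outcomeLaw (D.Q (h t)) (D.nextStrategy f (D.belief μ₀ h t) (h t))

/-- Integration of a function of the first outcomes by conditioning on all but the last of them. -/
lemma integral_historyLaw (μ₀ : ProbabilityMeasure Θ) (f : ProbabilityMeasure Θ → Strategy D.Γ)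
    {Y : (ℕ → Gr D.Γ) → ℝ} {t : ℕ} (hY : DependsOn Y (Set.Iic (t + 1))) :
    ∫ h, Y h ∂D.historyLaw μ₀ f
      = ∫ h, ∫ z, Y (Function.update h (t + 1) z) ∂D.nextLaw μ₀ f t h ∂D.historyLaw μ₀ f := by
  set r := Preorder.frestrictLe (π := fun _ => Gr D.Γ) t with hr
  have hrm : Measurable r := by fun_prop
  -- The arbitrary continuation chosen by `extend` is invisible to `Y`: coordinate `t + 1` is
  -- overwritten and later ones do not matter.
  set G : (Π _ : Finset.Iic t, Gr D.Γ) × Gr D.Γ → ℝ :=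
    fun a => Y (Function.update (D.extend a.1) (t + 1) a.2) with hG
  have hGY : ∀ h z, G (r h, z) = Y (Function.update h (t + 1) z) := fun h z => by
    refine hY fun i hi => ?_
    rcases eq_or_ne i (t + 1) with rfl | hne
    · simp
    · rw [Function.update_of_ne hne, Function.update_of_ne hne]
      exact extend_frestrictLe h (Nat.le_of_lt_succ (lt_of_le_of_ne hi hne))
  have hstep : ∀ h, D.stepKernel μ₀ f t (r h) = D.nextLaw μ₀ f t h := fun h => by
    change outcomeLaw _ _ = outcomeLaw _ _
    rw [belief_congr μ₀ (h := D.extend (r h)) (h' := h) fun i hi => extend_frestrictLe h hi,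
      show D.extend (r h) t = h t from extend_frestrictLe h le_rfl]
  have hmap := Kernel.map_frestrictLe_trajMeasure_compProd_eq_map_trajMeasure
    (X := fun _ => Gr D.Γ) (μ₀ := outcomeLaw D.q₀ (f μ₀)) (κ := D.stepKernel μ₀ f) (a := t)
  have hGm : Measurable G := measurable_of_countable _
  calc ∫ h, Y h ∂D.historyLaw μ₀ f = ∫ h, G (r h, h (t + 1)) ∂D.historyLaw μ₀ f := by
        simp_rw [hGY, Function.update_eq_self]
    _ = ∫ a, G a ∂((D.historyLaw μ₀ f).map fun h => (r h, h (t + 1))) :=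
        (integral_map (by fun_prop) hGm.aestronglyMeasurable).symm
    _ = ∫ a, G a ∂((D.historyLaw μ₀ f).map r ⊗ₘ D.stepKernel μ₀ f t) := by
        rw [historyLaw, hmap]
    _ = ∫ u, ∫ z, G (u, z) ∂D.stepKernel μ₀ f t u ∂((D.historyLaw μ₀ f).map r) := by
        have : IsProbabilityMeasure ((D.historyLaw μ₀ f).map r) :=
          Measure.isProbabilityMeasure_map hrm.aemeasurable
        exact Measure.integral_compProd Integrable.of_finite
    _ = ∫ h, ∫ z, G (r h, z) ∂D.stepKernel μ₀ f t (r h) ∂D.historyLaw μ₀ f :=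
        integral_map hrm.aemeasurable (measurable_of_countable _).aestronglyMeasurable
    _ = _ := by simp_rw [hGY, hstep]

/-- Strong law of large numbers for bounded martingale differences of the history process. -/
lemma ae_tendsto_average (μ₀ : ProbabilityMeasure Θ) (f : ProbabilityMeasure Θ → Strategy D.Γ)
    {x : ℕ → (ℕ → Gr D.Γ) → ℝ} (hdep : ∀ t, DependsOn (x t) (Set.Iic (t + 1)))
    (hx : ∀ t h, |x t h| ≤ 1)
    (hmean : ∀ t h, ∫ z, x t (Function.update h (t + 1) z) ∂D.nextLaw μ₀ f t h = 0) :
    ∀ᵐ h ∂D.historyLaw μ₀ f,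
      Tendsto (fun n : ℕ => (∑ t ∈ Finset.range n, x t h) / n) atTop (𝓝 0) := by
  refine ae_tendsto_sum_div_of_integral_sq_le (fun t => measurable_of_dependsOn (hdep t)) hx
    fun n => ?_
  have hS : ∀ n, DependsOn (fun h => ∑ t ∈ Finset.range n, x t h) (Set.Iic n) :=
    fun n h h' hh => Finset.sum_congr rfl fun t ht => hdep t fun i hi =>
      hh i (Set.mem_Iic.2 ((Set.mem_Iic.1 hi).trans (Finset.mem_range.1 ht)))
  induction n with
  | zero => simp
  | succ n ih =>
    have hS' : DependsOn (fun h => ∑ t ∈ Finset.range n, x t h) (Set.Iic (n + 1)) :=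
      fun h h' hh => hS n fun i hi => hh i (Set.mem_Iic.2 ((Set.mem_Iic.1 hi).trans n.le_succ))
    have hcross_dep : DependsOn (fun h => (∑ t ∈ Finset.range n, x t h) * x n h)
        (Set.Iic (n + 1)) := fun h h' hh => congrArg₂ _ (hS' hh) (hdep n hh)
    -- Martingale differences are orthogonal to the past, so each step adds at most `1` to the
    -- second moment.
    have hcross : ∫ h, (∑ t ∈ Finset.range n, x t h) * x n h ∂D.historyLaw μ₀ f = 0 := by
      rw [integral_historyLaw μ₀ f hcross_dep]
      refine integral_eq_zero_of_ae (ae_of_all _ fun h => ?_)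
      have : ∀ z, ∑ t ∈ Finset.range n, x t (Function.update h (n + 1) z)
          = ∑ t ∈ Finset.range n, x t h := fun z => hS n fun i hi =>
        Function.update_of_ne (Nat.lt_succ_of_le hi).ne _ _
      simp_rw [this]
      rw [integral_const_mul, hmean, mul_zero]; rfl
    have hsq_int : Integrable (fun h => (∑ t ∈ Finset.range n, x t h) ^ 2) (D.historyLaw μ₀ f) :=
      integrable_of_dependsOn μ₀ f (t := n) fun h h' hh => congrArg (· ^ 2) (hS n hh)
    have hxsq_int : Integrable (fun h => x n h ^ 2) (D.historyLaw μ₀ f) :=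
      integrable_of_dependsOn μ₀ f (t := n + 1) fun h h' hh => congrArg (· ^ 2) (hdep n hh)
    have hcross_int := integrable_of_dependsOn μ₀ f hcross_dep
    have hxsq : ∫ h, x n h ^ 2 ∂D.historyLaw μ₀ f ≤ 1 := by
      refine (integral_mono hxsq_int (integrable_const 1) fun h => ?_).trans (by simp)
      exact (sq_le_one_iff_abs_le_one _).2 (hx n h)
    have hexp : ∀ h, (∑ t ∈ Finset.range (n + 1), x t h) ^ 2
        = (∑ t ∈ Finset.range n, x t h) ^ 2 + 2 * ((∑ t ∈ Finset.range n, x t h) * x n h)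
          + x n h ^ 2 := fun h => by rw [Finset.sum_range_succ]; ring
    have hsum_int : Integrable (fun h => (∑ t ∈ Finset.range n, x t h) ^ 2
        + 2 * ((∑ t ∈ Finset.range n, x t h) * x n h)) (D.historyLaw μ₀ f) :=
      hsq_int.add (hcross_int.const_mul 2)
    simp_rw [hexp]
    rw [integral_add hsum_int hxsq_int,
      integral_add hsq_int (hcross_int.const_mul 2), integral_const_mul, hcross]
    push_cast
    linarith

/-- Almost surely only transitions of positive true probability occur. -/
lemma ae_transition_pos (μ₀ : ProbabilityMeasure Θ) (f : ProbabilityMeasure Θ → Strategy D.Γ) :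
    ∀ᵐ h ∂D.historyLaw μ₀ f, ∀ t, 0 < (D.Q (h t)).1 (h (t + 1)).state := by
  classical
  refine ae_all_iff.2 fun t => ?_
  set Y : (ℕ → Gr D.Γ) → ℝ := fun h => if (D.Q (h t)).1 (h (t + 1)).state = 0 then 1 else 0
    with hY
  have hdep : DependsOn Y (Set.Iic (t + 1)) := fun h h' hh => by
    simp only [hY, hh t t.le_succ, hh (t + 1) (le_refl (t + 1))]
  have hzero : ∫ h, Y h ∂D.historyLaw μ₀ f = 0 := by
    rw [integral_historyLaw μ₀ f hdep]
    refine integral_eq_zero_of_ae (ae_of_all _ fun h => ?_)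
    simp only [nextLaw]
    rw [integral_outcomeLaw]
    refine Finset.sum_eq_zero fun z _ => ?_
    simp only [hY, Function.update_self, Function.update_of_ne t.lt_succ_self.ne]
    split_ifs with h0
    · rw [h0, zero_mul, zero_mul]
    · rw [mul_zero]
  rw [integral_eq_zero_iff_of_nonneg (fun h => by simp only [hY]; split_ifs <;> simp)
    (integrable_of_dependsOn μ₀ f hdep)] at hzero
  filter_upwards [hzero] with h hh
  refine ((D.Q (h t)).2.1 _).lt_of_ne fun h0 => ?_
  simp [hY, ← h0] at hh

open Classical in
-- Given the past, the next state has law `Q (h t)`; on the event `h t = a.1` the centered indicator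
-- therefore has conditional mean zero.
lemma ae_tendsto_transition_average (μ₀ : ProbabilityMeasure Θ)
    (f : ProbabilityMeasure Θ → Strategy D.Γ) (a : Gr D.Γ × S) :
    ∀ᵐ h ∂D.historyLaw μ₀ f, Tendsto (fun n : ℕ => (∑ t ∈ Finset.range n,
      (if h t = a.1 then 1 else 0) * ((if (h (t + 1)).state = a.2 then 1 else 0)
        - (D.Q a.1).1 a.2)) / n) atTop (𝓝 0) := by
  have hQ := mem_Icc_of_mem_stdSimplex (D.Q a.1).2 a.2
  refine ae_tendsto_average μ₀ f (fun t h h' hh => ?_) (fun t h => ?_) fun t h => ?_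
  · simp only [hh t t.le_succ, hh (t + 1) (le_refl (t + 1))]
  · rw [abs_le]
    constructor <;> split_ifs <;> linarith [hQ.1, hQ.2]
  · simp only [nextLaw]
    rw [integral_outcomeLaw]
    simp only [Function.update_self, Function.update_of_ne t.lt_succ_self.ne]
    rw [sum_outcome_weights_state (φ := fun s => (if h t = a.1 then 1 else 0) *
      ((if s = a.2 then 1 else 0) - (D.Q a.1).1 a.2))]
    split_ifs with h0
    · simp [h0, mul_sub, Finset.sum_sub_distrib, ← Finset.sum_mul, (D.Q a.1).2.2]
    · simp

open Classical in
-- The action is drawn after the belief has been updated on the new state, so it is centered at the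
-- policy for the belief of period `t + 1`.
lemma ae_tendsto_action_average (μ₀ : ProbabilityMeasure Θ)
    (f : ProbabilityMeasure Θ → Strategy D.Γ) (z : Gr D.Γ) :
    ∀ᵐ h ∂D.historyLaw μ₀ f, Tendsto (fun n : ℕ => (∑ t ∈ Finset.range n,
      (if (h (t + 1)).state = z.state then 1 else 0) * ((if h (t + 1) = z then 1 else 0)
        - (f (D.belief μ₀ h (t + 1))).1 z.state z.action)) / n) atTop (𝓝 0) := by
  refine ae_tendsto_average μ₀ f (fun t h h' hh => ?_) (fun t h => ?_) fun t h => ?_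
  · simp only [hh (t + 1) (le_refl (t + 1)), belief_congr μ₀ hh]
  · have hf := mem_Icc_of_mem_stdSimplex ((f (D.belief μ₀ h (t + 1))).2 z.state).1 z.action
    rw [abs_le]
    constructor <;> split_ifs <;> linarith [hf.1, hf.2]
  · simp only [nextLaw]
    rw [integral_outcomeLaw]
    simp only [Function.update_self, belief, Function.update_of_ne t.lt_succ_self.ne]
    set p := D.Q (h t)
    set β := D.belief μ₀ h t
    have hβ : ∀ y, D.belief μ₀ (Function.update h (t + 1) y) t = β := fun y =>
      belief_congr μ₀ fun i hi => Function.update_of_ne (Nat.lt_succ_of_le hi).ne _ _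
    simp only [hβ]
    set g := D.nextStrategy f β (h t) with hg
    -- The updated belief depends on `y` only through its state, and only `y.state = z.state`
    -- contributes. Both resulting terms sum to the probability of `z`.
    have hterm : ∀ y : Gr D.Γ, p.1 y.state * g.1 y.state y.action *
        ((if y.state = z.state then 1 else 0) * ((if y = z then 1 else 0)
          - (f (D.bayes (h t) y.state β)).1 z.state z.action))
        = (if y = z then p.1 z.state * g.1 z.state z.action else 0)
          - p.1 y.state * g.1 y.state y.action * (if y.state = z.state then
            g.1 z.state z.action else 0) := fun y => by
      by_cases hy : y = z
      · subst hy; simp only [if_true, hg, nextStrategy]; ring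
      · by_cases hs : y.state = z.state
        · simp only [hy, hs, if_true, if_false, hg, nextStrategy]; ring
        · simp only [hy, hs, if_false]; ring
    simp_rw [hterm]
    rw [Finset.sum_sub_distrib, sum_outcome_weights_state (φ := fun s => if s = z.state then
      g.1 z.state z.action else 0)]
    simp

end SMDP

/-! ### Stationarity and the equilibrium property -/

namespace SMDP

variable {S X : Type*} [Fintype S] [Fintype X] {d : ℕ} {Θ : Set (EuclideanSpace ℝ (Fin d))}
  {D : SMDP S X Θ}

open Classical in
/-- Empirical outcome frequencies of the first `n` periods, for a history along which the
frequencies `freq` converge. -/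
lemma tendsto_average_of_tendsto_freq {h : ℕ → Gr D.Γ} {z : Gr D.Γ} {r : ℝ}
    (hz : Tendsto (fun t => D.freq h t z) atTop (𝓝 r)) :
    Tendsto (fun n : ℕ => (∑ t ∈ Finset.range n, if h t = z then (1 : ℝ) else 0) / n) atTop
      (𝓝 r) := by
  refine (tendsto_add_atTop_iff_nat 1).1 (hz.congr fun t => ?_)
  rw [freq, Nat.cast_succ, one_div, div_eq_inv_mul]

open Classical in
lemma tendsto_average_succ_of_tendsto_freq {h : ℕ → Gr D.Γ} {z : Gr D.Γ} {r : ℝ}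
    (hz : Tendsto (fun t => D.freq h t z) atTop (𝓝 r)) :
    Tendsto (fun n : ℕ => (∑ t ∈ Finset.range n, if h (t + 1) = z then (1 : ℝ) else 0) / n) atTop
      (𝓝 r) := by
  -- `freq h n` averages `n + 1` outcomes: the factor rescales to `n`, and the initial outcome is
  -- removed.
  have h1 : Tendsto (fun n : ℕ => D.freq h n z * (1 + 1 / (n : ℝ))
      - (if h 0 = z then (1 : ℝ) else 0) / n) atTop (𝓝 (r * (1 + 0) - 0)) :=
    (hz.mul (tendsto_one_div_atTop_nhds_zero_nat.const_add 1)).sub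
      (tendsto_const_nhds.div_atTop tendsto_natCast_atTop_atTop)
  rw [add_zero, mul_one, sub_zero] at h1
  refine h1.congr' ?_
  filter_upwards [eventually_gt_atTop 0] with n hn
  have hn' : (n : ℝ) ≠ 0 := by positivity
  have hn1 : (n : ℝ) + 1 ≠ 0 := by positivity
  rw [freq, Finset.sum_range_succ']
  field_simp
  ring

open Classical in
/-- Transition frequencies inherit their limit from the outcome frequencies. -/
lemma tendsto_seqFreq_transition {h : ℕ → Gr D.Γ} {m : OutcomeDist D.Γ} {a : Gr D.Γ × S}
    (hm : Tendsto (fun t => D.freq h t a.1) atTop (𝓝 (m.1 a.1)))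
    (ha : Tendsto (fun n : ℕ => (∑ t ∈ Finset.range n,
      (if h t = a.1 then 1 else 0) * ((if (h (t + 1)).state = a.2 then 1 else 0)
        - (D.Q a.1).1 a.2)) / n) atTop (𝓝 0)) :
    Tendsto (fun t => seqFreq (fun i => (h i, (h (i + 1)).state)) t a) atTop
      (𝓝 (D.transitionWeight m a)) := by
  have h1 := ha.add ((tendsto_average_of_tendsto_freq hm).mul_const ((D.Q a.1).1 a.2))
  rw [zero_add] at h1
  refine h1.congr fun n => ?_
  rw [seqFreq, div_mul_eq_mul_div, ← add_div, Finset.sum_mul, ← Finset.sum_add_distrib]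
  refine congrArg (· / (n : ℝ)) (Finset.sum_congr rfl fun t _ => ?_)
  rw [← mul_add, sub_add_cancel]
  by_cases h1 : h t = a.1 <;> by_cases h2 : (h (t + 1)).state = a.2 <;>
    simp [Prod.ext_iff, h1, h2]

open Classical in
/-- Limit outcome frequencies are stationary for the limit strategy. -/
lemma isStationary_of_tendsto {h : ℕ → Gr D.Γ} {m : OutcomeDist D.Γ} {σ : Strategy D.Γ}
    {g : ℕ → Strategy D.Γ} (hg : Tendsto g atTop (𝓝 σ))
    (hm : ∀ z, Tendsto (fun t => D.freq h t z) atTop (𝓝 (m.1 z)))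
    (hfreq : ∀ a, Tendsto (fun t => seqFreq (fun i => (h i, (h (i + 1)).state)) t a) atTop
      (𝓝 (D.transitionWeight m a)))
    (hact : ∀ z : Gr D.Γ, Tendsto (fun n : ℕ => (∑ t ∈ Finset.range n,
      (if (h (t + 1)).state = z.state then 1 else 0) * ((if h (t + 1) = z then 1 else 0)
        - (g (t + 1)).1 z.state z.action)) / n) atTop (𝓝 0)) :
    D.IsStationary σ m := by
  intro z
  -- Arrivals at a state are transitions into it, summed over their origins.
  have hstate : Tendsto (fun n : ℕ => (∑ t ∈ Finset.range n,
      if (h (t + 1)).state = z.state then (1 : ℝ) else 0) / n) atTop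
      (𝓝 (∑ y, D.transitionWeight m (y, z.state))) := by
    refine (tendsto_finsetSum Finset.univ fun y _ => hfreq (y, z.state)).congr fun n => ?_
    simp only [seqFreq]
    rw [← Finset.sum_div, Finset.sum_comm]
    refine congrArg (· / (n : ℝ)) (Finset.sum_congr rfl fun t _ => ?_)
    simp [Prod.ext_iff, ite_and]
  have hcoord : Tendsto (fun t => (g (t + 1)).1 z.state z.action - σ.1 z.state z.action) atTop
      (𝓝 0) := by
    have h1 : Continuous fun g : Strategy D.Γ => g.1 z.state z.action :=
      (continuous_apply _).comp ((continuous_apply _).comp continuous_subtype_val)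
    have h2 := ((h1.tendsto σ).comp hg).comp (tendsto_add_atTop_nat 1)
    simpa using h2.sub_const (σ.1 z.state z.action)
  -- Replacing the current strategy by its limit costs a Cesàro mean of a null sequence.
  have hnull : Tendsto (fun n : ℕ => (∑ t ∈ Finset.range n,
      (if (h (t + 1)).state = z.state then 1 else 0)
        * ((g (t + 1)).1 z.state z.action - σ.1 z.state z.action)) / n) atTop (𝓝 0) := by
    have h0 : Tendsto (fun t => (if (h (t + 1)).state = z.state then 1 else 0)
        * ((g (t + 1)).1 z.state z.action - σ.1 z.state z.action)) atTop (𝓝 0) := by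
      refine squeeze_zero_norm (fun t => ?_) (by simpa using hcoord.abs)
      split_ifs <;> simp
    exact h0.cesaro.congr fun n => (div_eq_inv_mul _ _).symm
  have hlim := ((hact z).add hnull).add (hstate.mul_const (σ.1 z.state z.action))
  rw [zero_add, zero_add] at hlim
  have hlim' := hlim.congr' (f₂ := fun n : ℕ =>
    (∑ t ∈ Finset.range n, if h (t + 1) = z then (1 : ℝ) else 0) / n)
    (Eventually.of_forall fun n => by
      rw [div_mul_eq_mul_div, ← add_div, ← add_div, Finset.sum_mul, ← Finset.sum_add_distrib,
        ← Finset.sum_add_distrib]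
      refine congrArg (· / (n : ℝ)) (Finset.sum_congr rfl fun t _ => ?_)
      by_cases hz : h (t + 1) = z
      · simp [hz]
      · simp only [hz, if_false]; ring)
  rw [tendsto_nhds_unique (tendsto_average_succ_of_tendsto_freq (hm z)) hlim', Finset.sum_mul]
  exact Finset.sum_congr rfl fun y _ => by rw [transitionWeight, MDP.transition]; ring

/-- The event of positive probability in the definition of stability contains a history along which
the frequencies of transitions converge and the limit outcome distribution is stationary. -/
lemma exists_typical_history {μ₀ : ProbabilityMeasure Θ}
    {f : ProbabilityMeasure Θ → Strategy D.Γ} {σ : Strategy D.Γ} {m : OutcomeDist D.Γ}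
    {H : Set (ℕ → Gr D.Γ)} (hH : 0 < D.historyLaw μ₀ f H)
    (hconv : ∀ h ∈ H, D.Converges μ₀ f σ m h) :
    ∃ h ∈ H, (∀ t, 0 < (D.Q (h t)).1 (h (t + 1)).state) ∧
      (∀ a, Tendsto (fun t => seqFreq (fun i => (h i, (h (i + 1)).state)) t a) atTop
        (𝓝 (D.transitionWeight m a))) ∧ D.IsStationary σ m := by
  have htrans := ae_all_iff.2 (ae_tendsto_transition_average (D := D) μ₀ f)
  have hact := ae_all_iff.2 (ae_tendsto_action_average (D := D) μ₀ f)
  obtain ⟨h, hh, ⟨hQ, htrans⟩, hact⟩ := ((frequently_ae_mem_iff.2 hH.ne').and_eventually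
    (((ae_transition_pos (D := D) μ₀ f).and htrans).and hact)).exists
  have hfreq : ∀ a, Tendsto (fun t => seqFreq (fun i => (h i, (h (i + 1)).state)) t a) atTop
      (𝓝 (D.transitionWeight m a)) :=
    fun a => tendsto_seqFreq_transition ((hconv h hh).2 a.1) (htrans a)
  exact ⟨h, hh, hQ, hfreq, isStationary_of_tendsto (g := fun t => f (D.belief μ₀ h t))
    (hconv h hh).1 (hconv h hh).2 hfreq hact⟩

/-- If the agent is myopic, stable pairs are Berk-Nash equilibria. -/
theorem IsStable.isBerkNash_zero {μ₀ : ProbabilityMeasure Θ}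
    {f : ProbabilityMeasure Θ → Strategy D.Γ} {σ : Strategy D.Γ} {m : OutcomeDist D.Γ}
    (hR : D.Regular) (hμ₀ : FullSupport μ₀) (hf : D.IsOptimalPolicy 0 f)
    (hstable : D.IsStable μ₀ f σ m) : D.IsBerkNash 0 σ m := by
  obtain ⟨H, -, hH, hconv⟩ := hstable
  obtain ⟨h, hh, hQ, hfreq, hstat⟩ := exists_typical_history hH hconv
  have : CompactSpace Θ := isCompact_iff_compactSpace.1 hR.compact
  -- Beliefs on a compact set form a compact space. An ultrafilter along which they converge
  -- replaces a subsequence; strategies still converge to `σ` along it.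
  obtain ⟨μ, hμ⟩ := exists_clusterPt_of_compactSpace (map (D.belief μ₀ h) atTop)
  obtain ⟨F, hF, hFμ⟩ := mapClusterPt_iff_ultrafilter.1 hμ
  exact ⟨μ, isOptimal_of_tendsto hR le_rfl zero_lt_one hf hFμ ((hconv h hh).1.mono_left hF)
    (Or.inl rfl), ae_mem_closest_of_tendsto hR hμ₀ hQ hfreq hF hFμ, hstat⟩

/-- For every discount factor, pairs that are stable with exhaustive learning are Berk-Nash
equilibria. -/
theorem IsStableExhaustive.isBerkNash {δ : ℝ} (hδ : 0 ≤ δ) (hδ1 : δ < 1)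
    {μ₀ : ProbabilityMeasure Θ} {f : ProbabilityMeasure Θ → Strategy D.Γ} {σ : Strategy D.Γ}
    {m : OutcomeDist D.Γ} (hR : D.Regular) (hμ₀ : FullSupport μ₀) (hf : D.IsOptimalPolicy δ f)
    (hstable : D.IsStableExhaustive μ₀ f σ m) : D.IsBerkNash δ σ m := by
  obtain ⟨H, -, hH, hconv⟩ := hstable
  obtain ⟨h, hh, hQ, hfreq, hstat⟩ := exists_typical_history hH fun h hh => (hconv h hh).1
  obtain ⟨⟨hσ, -⟩, μ, φ, hφ, hμ, hex⟩ := hconv h hh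
  have hF : map φ atTop ≤ atTop := hφ.tendsto_atTop
  exact ⟨μ, isOptimal_of_tendsto hR hδ hδ1 hf hμ (hσ.comp hφ.tendsto_atTop) (Or.inr hex),
    ae_mem_closest_of_tendsto hR hμ₀ hQ hfreq hF (tendsto_map'_iff.2 hμ), hstat⟩

end SMDP

end

theorem theorem2 {S X : Type*} [Fintype S] [Fintype X] {d : ℕ}
    {Θ : Set (EuclideanSpace ℝ (Fin d))} (D : SMDP S X Θ) :
    ∃ δbar : ℝ, 0 ≤ δbar ∧ δbar ≤ 1 ∧
      -- (i)
      (∀ δ : ℝ, 0 ≤ δ → δ < 1 → δ ≤ δbar →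
        ∀ (μ₀ : ProbabilityMeasure Θ) (f : ProbabilityMeasure Θ → Strategy D.Γ)
          (σ : Strategy D.Γ) (m : OutcomeDist D.Γ),
          D.Regular → FullSupport μ₀ → D.IsOptimalPolicy δ f →
          D.IsStable μ₀ f σ m → D.IsBerkNash δ σ m) ∧
      -- (ii)
      (∀ δ : ℝ, 0 ≤ δ → δ < 1 → δbar < δ →
        ∀ (μ₀ : ProbabilityMeasure Θ) (f : ProbabilityMeasure Θ → Strategy D.Γ)
          (σ : Strategy D.Γ) (m : OutcomeDist D.Γ),
          D.Regular → FullSupport μ₀ → D.IsOptimalPolicy δ f →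
          D.IsStableExhaustive μ₀ f σ m → D.IsBerkNash δ σ m) := by
  -- With threshold `0`, the first claim leaves only `δ = 0`.
  refine ⟨0, le_rfl, zero_le_one, fun δ hδ _ hδ' μ₀ f σ m hR hμ₀ hf hs => ?_,
    fun δ hδ hδ1 _ μ₀ f σ m hR hμ₀ hf hs => hs.isBerkNash hδ hδ1 hR hμ₀ hf⟩
  obtain rfl := le_antisymm hδ' hδ
  exact hs.isBerkNash_zero hR hμ₀ hf
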